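/- Let $c,\lambda>0$ and $m\in\{0,1\}$. Let $N$ be a homogeneous Poisson process with rate $\lambda$, let $s_1<s_2<\dots$ be its event times and $s_0=0$, and let $\theta_1,\theta_2,\dots$ be i.i.d., independent of $N$, with density $f_m(\theta)=\frac{\Gamma(m+1)}{\sqrt\pi\,\Gamma(m+\frac12)}\sin^{2m}\theta$ on $(0,\pi)$. For $s>0$ put $X_m(s)=c\sum_{j=1}^{N(s)+1}(s_j-s_{j-1})\cos\theta_j$, where in this sum $s_{N(s)+1}$ is replaced by $s$. Fix $t>0$ and let $G_1(t)$ be exponential with density $te^{-ts}$, $s>0$. The variable $X_m(G_1(t))$ denotes the position of the motion after a random duration $G_1(t)$ during which the velocity changes $N(t)$ times, the clock $G_1(t)$ being independent of $N(t)$; i.e. its law is $$P\{X_m(G_1(t))\in A\}=\sum_{n\ge0}P\{N(t)=n\}\int_0^\infty P\{X_m(s)\in A\mid N(s)=n\}\,te^{-ts}\,ds .$$ For $|x|<ct$ let $$p^0(x,t)=\frac{\lambda e^{-\lambda t}}{2c}\sum_{k=0}^\infty\Big(\frac{\lambda}{2c}\sqrt{c^2t^2-x^2}\Big)^{k-1}\frac1{\Gamma^2(\frac{k+1}2)},\qquad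 p^1(x,t)=\frac{e^{-\lambda t}}{c\sqrt{\lambda\pi t^3}}\sum_{k=0}^\infty\Big(\frac{\lambda}{c^2t}(c^2t^2-x^2)\Big)^{k+\frac12}\frac{k+1}{\Gamma(k+\frac32)} .$$ Then $p^m(\cdot,t)$ is the density of $X_m(t)$ (on $(-ct,ct)$), and $X_m(G_1(t))$ has on $\mathbb R$ the density $$x\mapsto\int_0^{ct}\frac{t^2}{2y}\,e^{-t^2|x|/y}\;2p^m(y,t)\,dy .$$ Moreover $X_m(G_1(t))$ is distributed as a Laplace variable with random parameter $t^2/|X_m(t)|$: for every Borel set $A$, $$P\{X_m(G_1(t))\in A\}=E\Big[\int_A\frac{t^2}{2|X_m(t)|}\,e^{-t^2|x|/|X_m(t)|}\,dx\Big].$$ -/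

import Mathlib

open MeasureTheory ProbabilityTheory
open scoped ENNReal

noncomputable section

namespace RandomMotion

/-- The law on `(0, π)` with density `Γ(ν+1) / (√π Γ(ν+1/2)) * (sin θ) ^ (2ν)`. -/
def angleMeasure (ν : ℝ) : Measure ℝ :=
  (volume.restrict (Set.Ioo 0 Real.pi)).withDensity fun θ =>
    ENNReal.ofReal (Real.Gamma (ν + 1) / (√Real.pi * Real.Gamma (ν + 1 / 2)) *
      Real.sin θ ^ (2 * ν))

variable {Ω : Type*}

/-- Epoch of the `k`-th Poisson event (`0` for `k = 0`), from the waiting times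
`ξ 0, ξ 1, …` between consecutive events. -/
def arrival (ξ : ℕ → Ω → ℝ) (k : ℕ) (ω : Ω) : ℝ :=
  ∑ i ∈ Finset.range k, ξ i ω

/-- `N(s)`: the number of Poisson events up to time `s`.  (The set of indices is almost surely
finite when the waiting times are independent and exponential.) -/
def count (ξ : ℕ → Ω → ℝ) (s : ℝ) (ω : Ω) : ℕ :=
  {k : ℕ | 1 ≤ k ∧ arrival ξ k ω ≤ s}.ncard

/-- The epochs `s_0 = 0, s_1, …, s_{N(s)}, s_{N(s)+1} = s` of the motion on `[0, s]`. -/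
def epoch (ξ : ℕ → Ω → ℝ) (s : ℝ) (k : ℕ) (ω : Ω) : ℝ :=
  if k ≤ count ξ s ω then arrival ξ k ω else s

/-- The position `X(s) = c ∑_{j=1}^{N(s)+1} (s_j - s_{j-1}) cos θ_j`; the index `j` here is
shifted by one, so that the angle of the `(j+1)`-st stretch is `θ j`. -/
def position (c : ℝ) (ξ θ : ℕ → Ω → ℝ) (s : ℝ) (ω : Ω) : ℝ :=
  c * ∑ j ∈ Finset.range (count ξ s ω + 1),
    (epoch ξ s (j + 1) ω - epoch ξ s j ω) * Real.cos (θ j ω)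

/-- The conditional law `P{X(s) ∈ · | N(s) = n}` of the position after a motion of duration `s`
with exactly `n` changes of velocity. -/
def condLaw [MeasurableSpace Ω] (P : Measure Ω) (c : ℝ) (ξ θ : ℕ → Ω → ℝ) (n : ℕ) (s : ℝ) :
    Measure ℝ :=
  (ProbabilityTheory.cond P {ω | count ξ s ω = n}).map (position c ξ θ s)

/-- The conditional law `P{X(G) ∈ · | N(t) = n}` of the position of the motion with `n` changes
of velocity whose duration `G` is random with law `τ`:
`∫ P{X(s) ∈ · | N(s) = n} P{G ∈ ds}`. -/
def condClockLaw [MeasurableSpace Ω] (P : Measure Ω) (c : ℝ) (ξ θ : ℕ → Ω → ℝ) (τ : Measure ℝ)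
    (n : ℕ) : Measure ℝ :=
  τ.bind (condLaw P c ξ θ n)

/-- The law of `X(G)`, where the random clock `G` has law `τ` and is independent of the number
`N(t)` of changes of velocity: `∑ₙ P{N(t) = n} P{X(G) ∈ · | N(t) = n}`. -/
def clockLaw [MeasurableSpace Ω] (P : Measure Ω) (c : ℝ) (ξ θ : ℕ → Ω → ℝ) (τ : Measure ℝ)
    (t : ℝ) : Measure ℝ :=
  Measure.sum fun n : ℕ => P {ω | count ξ t ω = n} • condClockLaw P c ξ θ τ n

/-- `p⁰(x, t)`, for `|x| < c t`. -/
def density₀ (c lam x t : ℝ) : ℝ :=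
  lam * Real.exp (-(lam * t)) / (2 * c) *
    ∑' k : ℕ, (lam / (2 * c) * √(c ^ 2 * t ^ 2 - x ^ 2)) ^ ((k : ℤ) - 1) *
      (1 / Real.Gamma (((k : ℝ) + 1) / 2) ^ 2)

/-- `p¹(x, t)`, for `|x| < c t`. -/
def density₁ (c lam x t : ℝ) : ℝ :=
  Real.exp (-(lam * t)) / (c * √(lam * Real.pi * t ^ 3)) *
    ∑' k : ℕ, (lam / (c ^ 2 * t) * (c ^ 2 * t ^ 2 - x ^ 2)) ^ ((k : ℝ) + 1 / 2) *
      (((k : ℝ) + 1) / Real.Gamma ((k : ℝ) + 3 / 2))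

/-- `pᵐ(x, t)`, for `|x| < c t` and `m = 0, 1`. -/
def density (m : Fin 2) (c lam x t : ℝ) : ℝ :=
  if m = 0 then density₀ c lam x t else density₁ c lam x t

/-- The centred Laplace law with parameter (rate) `r`, of density `(r / 2) exp (-r |x|)`. -/
def laplaceMeasure (r : ℝ) : Measure ℝ :=
  volume.withDensity fun x => ENNReal.ofReal (r / 2 * Real.exp (-(r * |x|)))

end RandomMotion

end

/-! Given n changes of velocity up to time s, the spacings are uniform on a simplex, so the k-th
conditional moment of X(s)/(cs) is the z^k coefficient of (∑ E[cos^k θ] z^k)^(n+1) divided by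
`choose (n+k) n`. `integral_dispPow` proves this together with the Poisson weight of the event, by
induction on n through the first waiting time.

For m = 0 the moment series of cos θ is (1 - z²)^(-1/2); for m = 1 it is the Catalan series in z²/4.
In both cases the coefficients of its powers are the same binomials times moments of a law with
density proportional to ((cs)² - x²)^((p-1)/2), where p = n or p = 2n+2
(`chooseSeries_sinMoment_pow`, `chooseSeries_sinMoment_two_pow`). Compactly supported laws are
determined by their moments (`ext_of_moments`), so this arc law is the conditional law of X(s)
(`IsFlight.map_displacement`). Summing over n with Poisson weights gives p^m term by term.

The arc law only scales with s: given n changes, X(s) is distributed as (s/t) X(t). An exponential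
clock of rate t therefore multiplies the conditional law at time t by an exponential variable of
rate t². Since that law is symmetric, the product is a Laplace mixture of rate t²/|x|
(`lintegral_laplaceMeasure_of_symm`). The resulting kernel does not depend on n, so averaging over
N(t) restores the unconditional law of X(t). -/

/-! ### Trigonometric moments on (0, π). -/

section SinMoments

open Real

/-- The `k`-th moment of `cos φ` when `φ ∈ (0, π)` has density proportional to `sin ^ p`. -/
noncomputable def sinMoment (p k : ℕ) : ℝ :=
  (∫ x in (0 : ℝ)..π, cos x ^ k * sin x ^ p) / ∫ x in (0 : ℝ)..π, sin x ^ p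

/-- Integration by parts: cos^(k+1) sin^(p+1) vanishes at both endpoints. -/
lemma integral_cos_pow_mul_sin_pow_succ (p k : ℕ) :
    (p + 1) * ∫ x in (0 : ℝ)..π, cos x ^ (k + 2) * sin x ^ p =
      (k + 1) * ∫ x in (0 : ℝ)..π, cos x ^ k * sin x ^ (p + 2) := by
  have h : ∀ x : ℝ, HasDerivAt (fun x => cos x ^ (k + 1) * sin x ^ (p + 1))
      ((p + 1) * (cos x ^ (k + 2) * sin x ^ p) - (k + 1) * (cos x ^ k * sin x ^ (p + 2))) x := by
    intro x
    convert! ((hasDerivAt_cos x).pow (k + 1)).mul ((hasDerivAt_sin x).pow (p + 1)) using 1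
    simp
    ring
  have := intervalIntegral.integral_eq_sub_of_hasDerivAt (a := 0) (b := π) (fun x _ => h x)
    (Continuous.intervalIntegrable (by fun_prop) _ _)
  rw [intervalIntegral.integral_sub (Continuous.intervalIntegrable (by fun_prop) _ _)
    (Continuous.intervalIntegrable (by fun_prop) _ _), intervalIntegral.integral_const_mul, intervalIntegral.integral_const_mul] at this
  simp at this
  linarith

/-- Writing sin² = 1 - cos² in the previous identity keeps p fixed. This recurrence drives both
generating function identities. -/
lemma sinMoment_add_two (p k : ℕ) :
    (k + p + 2) * sinMoment p (k + 2) = (k + 1) * sinMoment p k := by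
  have h1 := integral_cos_pow_mul_sin_pow_succ p k
  have h2 : ∫ x in (0 : ℝ)..π, cos x ^ k * sin x ^ (p + 2) =
      (∫ x in (0 : ℝ)..π, cos x ^ k * sin x ^ p) - ∫ x in (0 : ℝ)..π, cos x ^ (k + 2) * sin x ^ p := by
    rw [← intervalIntegral.integral_sub (Continuous.intervalIntegrable (by fun_prop) _ _)
      (Continuous.intervalIntegrable (by fun_prop) _ _)]
    congr 1 with x
    rw [pow_add (sin x), sin_sq]
    ring
  rw [h2] at h1
  unfold sinMoment
  rw [← mul_div_assoc, ← mul_div_assoc]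
  congr 1
  linarith

lemma sinMoment_zero (p : ℕ) : sinMoment p 0 = 1 := by
  simp only [sinMoment, pow_zero, one_mul]
  exact div_self (integral_sin_pow_pos (n := p)).ne'

lemma sinMoment_odd (p k : ℕ) : sinMoment p (2 * k + 1) = 0 := by
  induction k with
  | zero =>
    have h : ∀ x : ℝ, HasDerivAt (fun x => sin x ^ (p + 1)) ((p + 1) * (cos x ^ 1 * sin x ^ p)) x := by
      intro x
      convert! (hasDerivAt_sin x).pow (p + 1) using 1
      simp
      ring
    have := intervalIntegral.integral_eq_sub_of_hasDerivAt (a := 0) (b := π) (fun x _ => h x)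
      (Continuous.intervalIntegrable (by fun_prop) _ _)
    rw [intervalIntegral.integral_const_mul] at this
    simp only [sin_pi, sin_zero, sub_self, mul_eq_zero] at this
    rcases this with h | h
    · exact absurd h (by positivity)
    · simp only [sinMoment, mul_zero, zero_add, h, zero_div]
  | succ k ih =>
    have := sinMoment_add_two p (2 * k + 1)
    rw [ih, mul_zero, mul_eq_zero] at this
    rcases this with h | h
    · exact absurd h (by positivity)
    · exact h

lemma integral_sin_pow_add_two (p : ℕ) :
    (p + 2) * ∫ x in (0 : ℝ)..π, sin x ^ (p + 2) = (p + 1) * ∫ x in (0 : ℝ)..π, sin x ^ p := by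
  rw [integral_sin_pow]
  simp
  field_simp

lemma integral_sin_pow_eq_Gamma (p : ℕ) :
    (∫ x in (0 : ℝ)..π, sin x ^ p) = √π * Gamma ((p + 1) / 2) / Gamma (p / 2 + 1) := by
  induction p using Nat.twoStepInduction with
  | zero =>
    simp [Gamma_one_half_eq, -one_div, mul_self_sqrt pi_pos.le]
  | one =>
    have : Gamma (1 / 2 + 1) = √π / 2 := by
      rw [Gamma_add_one (by norm_num), Gamma_one_half_eq]; ring
    simp only [pow_one, integral_sin, cos_zero, cos_pi, Nat.cast_one, this]
    norm_num
    field_simp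
  | more p ih _ =>
    have h := integral_sin_pow_add_two p
    have h1 : Gamma (((p + 2 : ℕ) + 1) / 2) = (p + 1) / 2 * Gamma ((p + 1) / 2) := by
      rw [← Gamma_add_one (by positivity)]
      congr 1
      push_cast
      ring
    have h2 : Gamma ((p + 2 : ℕ) / 2 + 1) = (p / 2 + 1) * Gamma (p / 2 + 1) := by
      rw [← Gamma_add_one (by positivity)]
      congr 1
      push_cast
      ring
    have h3 : Gamma ((p : ℝ) / 2 + 1) ≠ 0 := (Gamma_pos_of_pos (by positivity)).ne'
    rw [h1, h2]
    rw [ih] at h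
    field_simp at h ⊢
    linarith

end SinMoments

/-! ### Powers of the moment series of cos θ. -/

section GeneratingFunctions

open PowerSeries

/-- The generating function of `choose (n + k) n * a k`. -/
noncomputable def chooseSeries (n : ℕ) (a : ℕ → ℝ) : PowerSeries ℝ :=
  PowerSeries.mk fun k => ((n + k).choose n : ℝ) * a k

lemma eq_of_twoStep_recurrence {f a b : ℕ → ℝ} (h0 : a 0 = b 0) (h1 : a 1 = b 1)
    (ha : ∀ k : ℕ, ((k : ℝ) + 2) * a (k + 2) = f k * a k)
    (hb : ∀ k : ℕ, ((k : ℝ) + 2) * b (k + 2) = f k * b k) : a = b := by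
  funext k
  induction k using Nat.twoStepInduction with
  | zero => exact h0
  | one => exact h1
  | more k ih _ =>
    have := ha k
    rw [ih, ← hb k] at this
    exact mul_left_cancel₀ (by positivity) this

lemma choose_add_two (n k : ℕ) : ((k : ℝ) + 2) * (k + 1) * (n + (k + 2)).choose n =
    (n + k + 2) * (n + k + 1) * (n + k).choose n := by
  have h1 := Nat.add_one_mul_choose_eq (n + k) k
  have h2 := Nat.add_one_mul_choose_eq (n + k + 1) (k + 1)
  rw [Nat.choose_symm_add (a := n) (b := k + 2), Nat.choose_symm_add (a := n) (b := k)]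
  have h1' : ((n : ℝ) + k + 1) * (n + k).choose k = (n + k + 1).choose (k + 1) * (k + 1) := by
    exact_mod_cast h1
  have h2' : ((n : ℝ) + k + 1 + 1) * (n + k + 1).choose (k + 1) =
      (n + k + 2).choose (k + 2) * (k + 1 + 1) := by
    exact_mod_cast h2
  rw [show n + (k + 2) = n + k + 2 by ring]
  linear_combination (-(k : ℝ) - 1) * h2' - (n + k + 2) * h1'

/-- Both sides are (1 - X²)^(-(n+1)/2). They solve (1 - X²) F' = (n+1) X F, which is the two-step
recurrence for the coefficients, with the same coefficients of degree 0 and 1. -/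
lemma chooseSeries_sinMoment_pow (n : ℕ) :
    (chooseSeries 0 (sinMoment 0)) ^ (n + 1) = chooseSeries n (sinMoment n) := by
  have hodd : ∀ n, coeff 1 (chooseSeries n (sinMoment n)) = 0 := fun n => by
    simp [chooseSeries, show sinMoment n 1 = 0 from sinMoment_odd n 0]
  have hrec : ∀ n k : ℕ, ((k : ℝ) + 2) * coeff (k + 2) (chooseSeries n (sinMoment n)) =
      (n + 1 + k) * coeff k (chooseSeries n (sinMoment n)) := by
    intro n k
    simp only [chooseSeries, coeff_mk]
    have h1 := choose_add_two n k
    have h2 := sinMoment_add_two n k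
    have : ((k : ℝ) + 1) * (k + n + 2) ≠ 0 := by positivity
    apply mul_left_cancel₀ this
    linear_combination (k + n + 2) * sinMoment n (k + 2) * h1 +
      (n + k + 2) * (n + k + 1) * (n + k).choose n * h2
  have hode : ∀ n, (1 - X ^ 2) * d⁄dX ℝ (chooseSeries n (sinMoment n)) =
      ((n : ℝ) + 1) • (X * chooseSeries n (sinMoment n)) := by
    intro n
    ext k
    rw [sub_mul, one_mul, map_sub, coeff_derivative, PowerSeries.coeff_smul]
    rcases k with _ | _ | k
    · simp [hodd, coeff_X_pow_mul']
    · have := hrec n 0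
      simp [coeff_X_pow_mul', coeff_succ_X_mul] at this ⊢
      linarith
    · have := hrec n (k + 1)
      rw [coeff_X_pow_mul', if_pos (by omega), show k + 1 + 1 - 2 = k by omega, coeff_succ_X_mul,
        coeff_derivative]
      push_cast at this ⊢
      simp only [smul_eq_mul]
      linear_combination this
  set B := chooseSeries 0 (sinMoment 0) with hB
  have hode' : (1 - X ^ 2) * d⁄dX ℝ (B ^ (n + 1)) = ((n : ℝ) + 1) • (X * B ^ (n + 1)) := by
    have := hode 0
    rw [← hB] at this
    rw [Derivation.leibniz_pow]
    simp only [Nat.cast_zero, zero_add, one_smul, add_tsub_cancel_right, smul_eq_mul] at this ⊢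
    rw [mul_smul_comm, mul_left_comm, this]
    rw [← Nat.cast_smul_eq_nsmul ℝ]
    push_cast
    congr 1
    ring
  have hB0 : constantCoeff B = 1 := by
    simp [hB, chooseSeries, sinMoment_zero]
  have h1 : coeff 1 (B ^ (n + 1)) = 0 := by
    have := congrArg (coeff 0) hode'
    rw [sub_mul, one_mul, map_sub, coeff_derivative] at this
    simpa [coeff_X_pow_mul'] using this
  have hr : ∀ k : ℕ, ((k : ℝ) + 2) * coeff (k + 2) (B ^ (n + 1)) =
      (n + 1 + k) * coeff k (B ^ (n + 1)) := by
    intro k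
    have := congrArg (coeff (k + 1)) hode'
    rw [sub_mul, one_mul, map_sub, coeff_derivative, PowerSeries.coeff_smul, coeff_succ_X_mul] at this
    rcases k with _ | k
    · simp [coeff_X_pow_mul'] at this ⊢
      linarith
    · rw [coeff_X_pow_mul', if_pos (by omega), show k + 1 + 1 - 2 = k by omega,
        coeff_derivative] at this
      push_cast at this ⊢
      simp only [smul_eq_mul] at this
      linear_combination this
  have := eq_of_twoStep_recurrence (f := fun k => (n : ℝ) + 1 + k)
    (a := fun k => coeff k (B ^ (n + 1))) (b := fun k => coeff k (chooseSeries n (sinMoment n)))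
    ?_ ?_ hr (hrec n)
  · ext k
    exact congrFun this k
  · simp [hB0, chooseSeries, sinMoment_zero]
  · simp only [h1, hodd]

/-- Multiplicativity of a family of power series with `T (N + 1) = T N + r X² T (N + 2)`. -/
lemma pow_of_threeTerm {T : ℕ → PowerSeries ℝ} {r : ℝ} (h0 : T 0 = 1)
    (h : ∀ N, T (N + 1) = T N + C r * X ^ 2 * T (N + 2)) (N : ℕ) : T N = T 1 ^ N := by
  -- Expanding T (a+1) leaves T a, handled by induction on a, and a multiple of X², handled by
  -- induction on the degree k.
  have key : ∀ k a b, coeff k (T a * T b) = coeff k (T (a + b)) := by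
    intro k
    induction k using Nat.strong_induction_on with
    | _ k ih =>
      intro a b
      induction a with
      | zero => simp [h0]
      | succ a iha =>
        rw [h a, show a + 1 + b = a + b + 1 by ring, h (a + b), add_mul, map_add, map_add, iha,
          mul_assoc (C r * X ^ 2), mul_assoc (C r), mul_assoc (C r), coeff_C_mul, coeff_C_mul,
          coeff_X_pow_mul', coeff_X_pow_mul']
        split_ifs with hk
        · rw [ih (k - 2) (by omega), show a + 2 + b = a + b + 2 by ring]
        · rfl
  induction N with
  | zero => simp [h0]
  | succ N ih =>
    rw [pow_succ, ← ih]
    ext k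
    exact (key k N 1).symm

/-- These are the ballot numbers, the coefficients of the (n+1)-st power of the Catalan series, at
X²/4. -/
lemma coeff_even_chooseSeries_sinMoment (n j : ℕ) :
    coeff (2 * j) (chooseSeries n (sinMoment (2 * n + 2))) =
      (n + 1) * (2 * j + n).factorial / (j.factorial * (j + n + 1).factorial * 4 ^ j) := by
  induction j with
  | zero =>
    have : (n.factorial : ℝ) ≠ 0 := by positivity
    simp [chooseSeries, sinMoment_zero, Nat.factorial_succ]
    field_simp
  | succ j ih =>
    have h1 := choose_add_two n (2 * j)
    have h2 := sinMoment_add_two (2 * n + 2) (2 * j)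
    simp only [chooseSeries, coeff_mk] at ih ⊢
    have h3 : (((n + (2 * j + 2)).choose n : ℕ) : ℝ) * sinMoment (2 * n + 2) (2 * j + 2) =
        (n + 2 * j + 2) * (n + 2 * j + 1) / ((2 * j + 2) * (2 * j + 2 * n + 4)) *
          (((n + 2 * j).choose n : ℕ) * sinMoment (2 * n + 2) (2 * j)) := by
      push_cast at h1 h2 ⊢
      have : (2 * (j : ℝ) + 1) * (2 * j + 2) * (2 * j + 2 * n + 4) ≠ 0 := by positivity
      rw [div_mul_eq_mul_div, eq_div_iff (by positivity)]
      apply mul_left_cancel₀ (show (2 * (j : ℝ) + 1) ≠ 0 by positivity)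
      linear_combination (2 * j + (2 * n + 2) + 2) * sinMoment (2 * n + 2) (2 * j + 2) * h1 +
        (n + 2 * j + 2) * (n + 2 * j + 1) * (n + 2 * j).choose n * h2
    rw [show 2 * (j + 1) = 2 * j + 2 by ring, h3, ih, show 2 * j + 2 + n = (2 * j + n) + 1 + 1 by ring,
      show j + 1 + n + 1 = (j + n + 1) + 1 by ring]
    have e1 : ((2 * j + n).factorial : ℝ) ≠ 0 := by positivity
    have e2 : ((j + n + 1).factorial : ℝ) ≠ 0 := by positivity
    have e3 : ((j).factorial : ℝ) ≠ 0 := by positivity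
    simp only [Nat.factorial_succ (2 * j + n + 1), Nat.factorial_succ (2 * j + n),
      Nat.factorial_succ (j + n + 1), Nat.factorial_succ j]
    push_cast
    field_simp
    ring

lemma coeff_odd_chooseSeries_sinMoment (n p j : ℕ) :
    coeff (2 * j + 1) (chooseSeries n (sinMoment p)) = 0 := by
  simp [chooseSeries, sinMoment_odd]

/-- The ballot numbers satisfy the three-term relation of the powers of T₁ = 1 + (X²/4) T₁², and
`pow_of_threeTerm` shows that this relation with T₀ = 1 forces powers. -/
lemma chooseSeries_sinMoment_two_pow (n : ℕ) :
    (chooseSeries 0 (sinMoment 2)) ^ (n + 1) = chooseSeries n (sinMoment (2 * n + 2)) := by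
  let T : ℕ → PowerSeries ℝ := fun N => N.casesOn 1 fun n => chooseSeries n (sinMoment (2 * n + 2))
  have hT : ∀ n, T (n + 1) = chooseSeries n (sinMoment (2 * n + 2)) := fun _ => rfl
  have h : ∀ N, T (N + 1) = T N + C (1 / 4) * X ^ 2 * T (N + 2) := by
    intro N
    ext k
    rw [map_add, mul_assoc, coeff_C_mul, coeff_X_pow_mul']
    obtain ⟨j, rfl | rfl⟩ := Nat.even_or_odd' k
    · rcases j with _ | j
      · rcases N with _ | n
        · simp [T, chooseSeries, sinMoment_zero]
        · simp [T, chooseSeries, sinMoment_zero]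
      · rw [if_pos (by omega), show 2 * (j + 1) - 2 = 2 * j by omega, hT, hT,
          coeff_even_chooseSeries_sinMoment, coeff_even_chooseSeries_sinMoment]
        rcases N with _ | n
        · have e1 : ((2 * j).factorial : ℝ) ≠ 0 := by positivity
          have e2 : ((j).factorial : ℝ) ≠ 0 := by positivity
          simp [T, coeff_one, Nat.factorial_succ, mul_add]
          field_simp
          ring
        · rw [hT, coeff_even_chooseSeries_sinMoment,
            show 2 * (j + 1) + (n + 1) = 2 * j + n + 1 + 1 + 1 by ring,
            show 2 * (j + 1) + n = 2 * j + n + 1 + 1 by ring,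
            show 2 * j + (n + 1 + 1) = 2 * j + n + 1 + 1 by omega,
            show j + 1 + (n + 1) + 1 = j + n + 1 + 1 + 1 by ring,
            show j + 1 + n + 1 = j + n + 1 + 1 by ring,
            show j + (n + 1 + 1) + 1 = j + n + 1 + 1 + 1 by ring]
          have e1 : ((2 * j + n).factorial : ℝ) ≠ 0 := by positivity
          have e2 : ((j + n).factorial : ℝ) ≠ 0 := by positivity
          have e3 : ((j).factorial : ℝ) ≠ 0 := by positivity
          simp only [Nat.factorial_succ (2 * j + n + 1 + 1), Nat.factorial_succ (2 * j + n + 1),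
            Nat.factorial_succ (2 * j + n), Nat.factorial_succ (j + n + 1 + 1),
            Nat.factorial_succ (j + n + 1), Nat.factorial_succ (j + n), Nat.factorial_succ j]
          push_cast
          field_simp
          ring
    · have h0 : coeff (2 * j + 1) (T N) = 0 := by
        rcases N with _ | n
        · simp [T, coeff_one]
        · rw [hT, coeff_odd_chooseSeries_sinMoment]
      rw [h0, hT, hT, coeff_odd_chooseSeries_sinMoment]
      split_ifs with hj
      · rw [show 2 * j + 1 - 2 = 2 * (j - 1) + 1 by omega, coeff_odd_chooseSeries_sinMoment]
        simp
      · simp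
  exact (pow_of_threeTerm (T := T) rfl h (n + 1)).symm

end GeneratingFunctions

/-! ### Beta integrals and the exponential law. -/

section ExpMeasure

lemma integral_pow_mul_sub_pow (i p : ℕ) (s : ℝ) :
    ∫ x in (0 : ℝ)..s, x ^ i * (s - x) ^ p =
      i.factorial * p.factorial / (i + p + 1).factorial * s ^ (i + p + 1) := by
  induction p generalizing i with
  | zero =>
    have : (i.factorial : ℝ) ≠ 0 := by positivity
    simp [Nat.factorial_succ]
    field_simp
  | succ p ih =>
    have h : ∀ x : ℝ, HasDerivAt (fun x => x ^ (i + 1) * (s - x) ^ (p + 1))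
        ((i + 1) * (x ^ i * (s - x) ^ (p + 1)) - (p + 1) * (x ^ (i + 1) * (s - x) ^ p)) x := by
      intro x
      convert! (hasDerivAt_pow (i + 1) x).mul (((hasDerivAt_id x).const_sub s).pow (p + 1)) using 1
      simp
      ring
    have := intervalIntegral.integral_eq_sub_of_hasDerivAt (a := 0) (b := s) (fun x _ => h x)
      (Continuous.intervalIntegrable (by fun_prop) _ _)
    rw [intervalIntegral.integral_sub (Continuous.intervalIntegrable (by fun_prop) _ _)
      (Continuous.intervalIntegrable (by fun_prop) _ _), intervalIntegral.integral_const_mul,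
      intervalIntegral.integral_const_mul, ih] at this
    simp only [sub_self, ne_eq, Nat.succ_ne_zero, not_false_eq_true, zero_pow, mul_zero,
      zero_mul] at this
    have h3 : ((i : ℝ) + 1) ≠ 0 := by positivity
    apply mul_left_cancel₀ h3
    rw [sub_eq_zero.mp this, show i + 1 + p + 1 = i + (p + 1) + 1 by ring,
      Nat.factorial_succ i, Nat.factorial_succ p]
    push_cast
    ring

lemma setIntegral_expMeasure_Ioc (lam : ℝ) {s : ℝ} (hlam : 0 < lam) (hs : 0 ≤ s) (f : ℝ → ℝ) :
    ∫ x in Set.Ioc 0 s, f x ∂expMeasure lam =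
      ∫ x in (0 : ℝ)..s, lam * Real.exp (-(lam * x)) * f x := by
  have : expMeasure lam = volume.withDensity fun x => ENNReal.ofReal (exponentialPDFReal lam x) := rfl
  rw [this, restrict_withDensity measurableSet_Ioc,
    integral_withDensity_eq_integral_toReal_smul (by fun_prop) (ae_of_all _ fun _ => by simp),
    intervalIntegral.integral_of_le hs]
  refine setIntegral_congr_fun measurableSet_Ioc fun x hx => ?_
  simp only [smul_eq_mul]
  rw [ENNReal.toReal_ofReal (exponentialPDFReal_nonneg hlam x)]
  simp [exponentialPDFReal, gammaPDFReal, hx.1.le]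

lemma expMeasure_real_Ioi {lam s : ℝ} (hlam : 0 < lam) (hs : 0 ≤ s) :
    (expMeasure lam).real (Set.Ioi s) = Real.exp (-(lam * s)) := by
  have := isProbabilityMeasure_expMeasure hlam
  have h := cdf_expMeasure_eq hlam s
  rw [if_pos hs, cdf_eq_real] at h
  rw [← Set.compl_Iic, probReal_compl_eq_one_sub measurableSet_Iic, h]
  ring

lemma ae_expMeasure_pos {t : ℝ} (ht : 0 < t) : ∀ᵐ s ∂expMeasure t, 0 < s := by
  have := isProbabilityMeasure_expMeasure ht
  have h : ∀ᵐ s ∂expMeasure t, s ∈ Set.Ioi 0 := by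
    rw [Filter.eventually_mem_set, mem_ae_iff_prob_eq_one measurableSet_Ioi, ← ofReal_measureReal,
      expMeasure_real_Ioi ht le_rfl]
    simp
  exact h

end ExpMeasure

/-! ### Mixed moments of displacement and number of changes. -/

namespace RandomMotion

/-- With waiting times `x 0, x 1, …`, exactly `n` events occur up to time `s`. -/
def Occurs (n : ℕ) (s : ℝ) (x : ℕ → ℝ) : Prop :=
  (∀ i ≤ n, 0 < x i) ∧ ∑ i ∈ Finset.range n, x i ≤ s ∧ s < ∑ i ∈ Finset.range (n + 1), x i

/-- Displacement at unit speed up to time `s` after `n` changes of direction. -/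
noncomputable def displacement (n : ℕ) (s : ℝ) (x y : ℕ → ℝ) : ℝ :=
  ∑ j ∈ Finset.range n, x j * Real.cos (y j) + (s - ∑ j ∈ Finset.range n, x j) * Real.cos (y n)

open Classical in
/-- The `k`-th power of the displacement on the event of exactly `n` changes. -/
noncomputable def dispPow (n k : ℕ) (s : ℝ) (z : (ℕ → ℝ) × (ℕ → ℝ)) : ℝ :=
  if Occurs n s z.1 then displacement n s z.1 z.2 ^ k else 0

/-- Renewal at the first event. As `Occurs` demands positivity of the waiting times it involves,
this holds for every sequence, with no null set removed. -/
lemma occurs_succ {n : ℕ} {s : ℝ} {x : ℕ → ℝ} :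
    Occurs (n + 1) s x ↔ 0 < x 0 ∧ Occurs n (s - x 0) (fun i => x (i + 1)) := by
  unfold Occurs
  rw [Finset.sum_range_succ' x n, Finset.sum_range_succ' x (n + 1)]
  constructor
  · rintro ⟨h1, h2, h3⟩
    exact ⟨h1 0 (by omega), fun i hi => h1 (i + 1) (by omega), by linarith, by linarith⟩
  · rintro ⟨h0, h1, h2, h3⟩
    refine ⟨fun i hi => ?_, by linarith, by linarith⟩
    rcases i with _ | i
    · exact h0
    · exact h1 i (by omega)

lemma Occurs.sum_nonneg {n : ℕ} {s : ℝ} {x : ℕ → ℝ} (h : Occurs n s x) :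
    0 ≤ ∑ i ∈ Finset.range n, x i :=
  Finset.sum_nonneg fun i hi => (h.1 i (Finset.mem_range.mp hi).le).le

lemma Occurs.nonneg {n : ℕ} {s : ℝ} {x : ℕ → ℝ} (h : Occurs n s x) : 0 ≤ s :=
  h.sum_nonneg.trans h.2.1

lemma Occurs.abs_displacement_le {n : ℕ} {s : ℝ} {x : ℕ → ℝ} (h : Occurs n s x) (y : ℕ → ℝ) :
    |displacement n s x y| ≤ s := by
  have h1 : |∑ j ∈ Finset.range n, x j * Real.cos (y j)| ≤ ∑ j ∈ Finset.range n, x j := by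
    refine (Finset.abs_sum_le_sum_abs _ _).trans (Finset.sum_le_sum fun i hi => ?_)
    have hx := h.1 i (Finset.mem_range.mp hi).le
    rw [abs_mul, abs_of_pos hx]
    exact mul_le_of_le_one_right hx.le (Real.abs_cos_le_one _)
  have h2 : |(s - ∑ j ∈ Finset.range n, x j) * Real.cos (y n)| ≤ s - ∑ j ∈ Finset.range n, x j := by
    have := sub_nonneg.mpr h.2.1
    rw [abs_mul, abs_of_nonneg this]
    exact mul_le_of_le_one_right this (Real.abs_cos_le_one _)
  calc _ ≤ _ := abs_add_le _ _
    _ ≤ _ := add_le_add h1 h2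
    _ = s := by ring

lemma displacement_succ (n : ℕ) (s : ℝ) (x y : ℕ → ℝ) :
    displacement (n + 1) s x y = x 0 * Real.cos (y 0) +
      displacement n (s - x 0) (fun i => x (i + 1)) (fun i => y (i + 1)) := by
  simp only [displacement, Finset.sum_range_succ' _ n]
  ring

lemma dispPow_of_neg {n k : ℕ} {s : ℝ} (hs : s < 0) (z : (ℕ → ℝ) × (ℕ → ℝ)) :
    dispPow n k s z = 0 :=
  if_neg fun h => hs.not_ge h.nonneg

lemma abs_dispPow_le (n k : ℕ) (s : ℝ) (z : (ℕ → ℝ) × (ℕ → ℝ)) : |dispPow n k s z| ≤ |s| ^ k := by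
  unfold dispPow
  split_ifs with h
  · rw [abs_pow]
    exact pow_le_pow_left₀ (abs_nonneg _) ((h.abs_displacement_le _).trans (le_abs_self s)) k
  · simp

lemma measurableSet_occurs (n : ℕ) :
    MeasurableSet {q : ℝ × (ℕ → ℝ) × (ℕ → ℝ) | Occurs n q.1 q.2.1} := by
  have : {q : ℝ × (ℕ → ℝ) × (ℕ → ℝ) | Occurs n q.1 q.2.1} =
      (⋂ i, ⋂ (_ : i ≤ n), {q | 0 < q.2.1 i}) ∩ ({q | ∑ i ∈ Finset.range n, q.2.1 i ≤ q.1} ∩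
        {q | q.1 < ∑ i ∈ Finset.range (n + 1), q.2.1 i}) := by
    ext q
    simp [Occurs]
  rw [this]
  refine .inter (.iInter fun i => .iInter fun _ => measurableSet_lt ?_ ?_)
    (.inter (measurableSet_le ?_ ?_) (measurableSet_lt ?_ ?_)) <;> fun_prop

lemma measurable_displacement (n : ℕ) :
    Measurable fun q : ℝ × (ℕ → ℝ) × (ℕ → ℝ) => displacement n q.1 q.2.1 q.2.2 := by
  unfold displacement
  fun_prop

lemma measurable_dispPow (n k : ℕ) :
    Measurable fun q : ℝ × (ℕ → ℝ) × (ℕ → ℝ) => dispPow n k q.1 q.2 :=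
  Measurable.ite (measurableSet_occurs n) ((measurable_displacement n).pow_const k)
    measurable_const

/-- Binomial expansion of first stretch plus remainder; each summand separates the first pair from
the shifted sequences. -/
lemma dispPow_succ (n k : ℕ) (s : ℝ) (x y : ℕ → ℝ) :
    dispPow (n + 1) k s (x, y) = ∑ p ∈ Finset.HasAntidiagonal.antidiagonal k, (k.choose p.1 : ℝ) *
      ((Set.Ioi 0).indicator (fun a => a ^ p.1) (x 0) * Real.cos (y 0) ^ p.1 *
        dispPow n p.2 (s - x 0) (fun i => x (i + 1), fun i => y (i + 1))) := by
  unfold dispPow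
  rw [occurs_succ, displacement_succ]
  by_cases h0 : 0 < x 0
  · by_cases h : Occurs n (s - x 0) (fun i => x (i + 1))
    · simp only [h0, h, and_self, if_true]
      rw [(Commute.all _ _).add_pow']
      refine Finset.sum_congr rfl fun p _ => ?_
      rw [Set.indicator_of_mem (by exact h0), nsmul_eq_mul, mul_pow]
    · simp [h]
  · simp [h0]

section Moments

variable {Ω : Type*} [MeasurableSpace Ω] {P : Measure Ω}

lemma indepFun_first_shift {ξ θ : ℕ → Ω → ℝ}
    (hξ : ∀ i, Measurable (ξ i)) (hθ : ∀ j, Measurable (θ j)) (h : iIndepFun (Sum.elim ξ θ) P) :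
    IndepFun (fun ω => (ξ 0 ω, θ 0 ω))
      (fun ω => ((fun i => ξ (i + 1) ω, fun i => θ (i + 1) ω) : (ℕ → ℝ) × (ℕ → ℝ))) P := by
  have hm : ∀ i, Measurable (Sum.elim ξ θ i) := by rintro (i | i) <;> simp [hξ, hθ]
  let S : Set (ℕ ⊕ ℕ) := {Sum.inl 0, Sum.inr 0}
  have := indep_iSup_of_disjoint (fun i => (hm i).comap_le) h (S := S) (T := Sᶜ) disjoint_compl_right
  have hle : ∀ (U : Set (ℕ ⊕ ℕ)) (i), i ∈ U →
      Measurable[⨆ i ∈ U, MeasurableSpace.comap (Sum.elim ξ θ i) inferInstance] (Sum.elim ξ θ i) := by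
    intro U i hi
    exact (comap_measurable _).mono
      (le_iSup₂_of_le (f := fun i (_ : i ∈ U) => MeasurableSpace.comap (Sum.elim ξ θ i) inferInstance)
        i hi le_rfl) le_rfl
  rw [IndepFun_iff_Indep]
  refine indep_of_indep_of_le_left (indep_of_indep_of_le_right this ?_) ?_
  · rw [← measurable_iff_comap_le]
    refine @Measurable.prodMk _ _ _ _ _ (_) _ _ ?_ ?_
    · refine @measurable_pi_lambda _ _ _ (_) _ _ fun i => ?_
      exact hle Sᶜ (Sum.inl (i + 1)) (by simp [S])
    · refine @measurable_pi_lambda _ _ _ (_) _ _ fun i => ?_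
      exact hle Sᶜ (Sum.inr (i + 1)) (by simp [S])
  · rw [← measurable_iff_comap_le]
    refine @Measurable.prodMk _ _ _ _ _ (_) _ _ ?_ ?_
    · exact hle S (Sum.inl 0) (by simp [S])
    · exact hle S (Sum.inr 0) (by simp [S])

lemma map_first_pair [IsProbabilityMeasure P] {ξ θ : ℕ → Ω → ℝ} {β α : Measure ℝ}
    (hξ : ∀ i, Measurable (ξ i)) (hθ : ∀ j, Measurable (θ j)) (h : iIndepFun (Sum.elim ξ θ) P)
    (hβ : ∀ i, P.map (ξ i) = β) (hα : ∀ j, P.map (θ j) = α) :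
    P.map (fun ω => (ξ 0 ω, θ 0 ω)) = β.prod α := by
  rw [← hβ 0, ← hα 0]
  exact (indepFun_iff_map_prod_eq_prod_map_map (hξ 0).aemeasurable (hθ 0).aemeasurable).mp
    (h.indepFun (i := Sum.inl 0) (j := Sum.inr 0) (by simp))

/-- The mixed moments of the displacement and the number of changes of direction. -/
theorem integral_dispPow [IsProbabilityMeasure P] {α : Measure ℝ} {lam : ℝ} (hlam : 0 < lam) (n : ℕ) :
    ∀ {ξ θ : ℕ → Ω → ℝ} (_ : ∀ i, Measurable (ξ i)) (_ : ∀ j, Measurable (θ j))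
    (_ : ∀ i, P.map (ξ i) = expMeasure lam) (_ : ∀ j, P.map (θ j) = α)
    (_ : iIndepFun (Sum.elim ξ θ) P) (k : ℕ) {s : ℝ} (_ : 0 ≤ s),
    ∫ ω, dispPow n k s (fun i => ξ i ω, fun i => θ i ω) ∂P =
      lam ^ n * Real.exp (-(lam * s)) * k.factorial *
        PowerSeries.coeff k ((PowerSeries.mk fun k => ∫ y, Real.cos y ^ k ∂α) ^ (n + 1)) *
        s ^ (n + k) / (n + k).factorial := by
  have := isProbabilityMeasure_expMeasure hlam
  induction n with
  | zero =>
    intro ξ θ hξ hθ hβ hα h k s hs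
    have hαp : IsProbabilityMeasure α := hα 0 ▸ Measure.isProbabilityMeasure_map (hθ 0).aemeasurable
    -- Without a change the displacement is s cos θ₀, on the event that the first waiting time
    -- exceeds s.
    have h1 : ∀ ω, dispPow 0 k s (fun i => ξ i ω, fun i => θ i ω) =
        (fun q : ℝ × ℝ => (Set.Ioi s).indicator 1 q.1 * (s * Real.cos q.2) ^ k) (ξ 0 ω, θ 0 ω) := by
      intro ω
      by_cases h0 : s < ξ 0 ω
      · simp [dispPow, Occurs, displacement, h0, hs, hs.trans_lt h0]
      · simp [dispPow, Occurs, h0]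
    have hm : Measurable fun q : ℝ × ℝ => (Set.Ioi s).indicator (1 : ℝ → ℝ) q.1 * (s * Real.cos q.2) ^ k := by
      refine Measurable.mul ((measurable_one.indicator measurableSet_Ioi).comp measurable_fst) ?_
      fun_prop
    simp_rw [h1]
    rw [← integral_map (φ := fun ω => (ξ 0 ω, θ 0 ω)) (by fun_prop) hm.aestronglyMeasurable,
      map_first_pair hξ hθ h hβ hα,
      integral_prod_mul (fun x => (Set.Ioi s).indicator (1 : ℝ → ℝ) x) (fun y => (s * Real.cos y) ^ k),
      integral_indicator_one measurableSet_Ioi, expMeasure_real_Ioi hlam hs]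
    simp_rw [mul_pow]
    rw [integral_const_mul]
    have : (k.factorial : ℝ) ≠ 0 := by positivity
    simp
    field_simp
  | succ n ih =>
    intro ξ θ hξ hθ hβ hα h k s hs
    have hαp : IsProbabilityMeasure α := hα 0 ▸ Measure.isProbabilityMeasure_map (hθ 0).aemeasurable
    let e : ℕ → ℝ := fun k => ∫ y, Real.cos y ^ k ∂α
    let b : ℕ → ℝ := fun j => PowerSeries.coeff j (PowerSeries.mk e ^ (n + 1))
    -- The induction hypothesis for the shifted sequences, extended by zero to negative remaining
    -- time, which arises when the first waiting time exceeds s.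
    have ih' : ∀ (k : ℕ) (s : ℝ), ∫ ω, dispPow n k s (fun i => ξ (i + 1) ω, fun i => θ (i + 1) ω) ∂P =
        (Set.Ici 0).indicator (fun s => lam ^ n * Real.exp (-(lam * s)) * k.factorial *
          b k * s ^ (n + k) / (n + k).factorial) s := by
      intro k s
      by_cases hs : 0 ≤ s
      · rw [Set.indicator_of_mem (by exact hs)]
        refine ih (fun i => hξ _) (fun i => hθ _) (fun i => hβ _) (fun i => hα _) ?_ k hs
        have := h.precomp (g := Sum.map Nat.succ Nat.succ)
          (Sum.map_injective.mpr ⟨Nat.succ_injective, Nat.succ_injective⟩)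
        convert this using 1
        ext (i | i) <;> rfl
      · rw [Set.indicator_of_notMem (by simpa using hs)]
        simp [dispPow_of_neg (not_le.mp hs)]
    let V : Ω → (ℕ → ℝ) × (ℕ → ℝ) := fun ω => (fun i => ξ (i + 1) ω, fun i => θ (i + 1) ω)
    have hV : Measurable V := by fun_prop
    let F : ℕ × ℕ → (ℝ × ℝ) × ((ℕ → ℝ) × (ℕ → ℝ)) → ℝ := fun p q => (k.choose p.1 : ℝ) *
      ((Set.Ioi 0).indicator (fun a => a ^ p.1) q.1.1 * Real.cos q.1.2 ^ p.1 *
        dispPow n p.2 (s - q.1.1) q.2)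
    let H : (ℝ × ℝ) × ((ℕ → ℝ) × (ℕ → ℝ)) → ℝ := fun q => ∑ p ∈ Finset.HasAntidiagonal.antidiagonal k, F p q
    have hFm : ∀ p, Measurable (F p) := by
      intro p
      refine Measurable.const_mul (Measurable.mul (Measurable.mul ?_ (by fun_prop)) ?_) _
      · exact ((measurable_id.pow_const p.1).indicator measurableSet_Ioi).comp
          (measurable_fst.comp measurable_fst)
      · exact (measurable_dispPow n p.2).comp
          (f := fun q : (ℝ × ℝ) × ((ℕ → ℝ) × (ℕ → ℝ)) => (s - q.1.1, q.2)) (by fun_prop)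
    have hFb : ∀ p q, |F p q| ≤ (k.choose p.1 : ℝ) * (s ^ p.1 * s ^ p.2) := by
      intro p q
      simp only [F, abs_mul, Nat.abs_cast]
      refine mul_le_mul_of_nonneg_left ?_ (by positivity)
      by_cases hq : q.1.1 ∈ Set.Ioc 0 s
      · rw [Set.indicator_of_mem (by exact hq.1), abs_pow, abs_pow, abs_of_pos hq.1]
        have h1 : |Real.cos q.1.2| ^ p.1 ≤ 1 := pow_le_one₀ (abs_nonneg _) (Real.abs_cos_le_one _)
        have h2 : q.1.1 ^ p.1 ≤ s ^ p.1 := pow_le_pow_left₀ hq.1.le hq.2 _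
        have h3 : |dispPow n p.2 (s - q.1.1) q.2| ≤ s ^ p.2 := by
          refine (abs_dispPow_le _ _ _ _).trans (pow_le_pow_left₀ (abs_nonneg _) ?_ _)
          rw [abs_of_nonneg (sub_nonneg.mpr hq.2)]
          linarith [hq.1]
        refine mul_le_mul ((mul_le_mul h2 h1 (by positivity) (by positivity)).trans_eq (mul_one _))
          h3 (abs_nonneg _) (by positivity)
      · have : (Set.Ioi 0).indicator (fun a => a ^ p.1) q.1.1 * dispPow n p.2 (s - q.1.1) q.2 = 0 := by
          by_cases h0 : 0 < q.1.1
          · rw [dispPow_of_neg, mul_zero]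
            have : ¬ q.1.1 ≤ s := fun h => hq ⟨h0, h⟩
            linarith
          · rw [Set.indicator_of_notMem (by simpa using h0), zero_mul]
        rw [mul_right_comm, ← abs_mul, this]
        simp
        positivity
    have hlaw : P.map (fun ω => ((ξ 0 ω, θ 0 ω), V ω)) = ((expMeasure lam).prod α).prod (P.map V) := by
      rw [← map_first_pair hξ hθ h hβ hα]
      exact (indepFun_iff_map_prod_eq_prod_map_map (by fun_prop) hV.aemeasurable).mp
        (indepFun_first_shift hξ hθ h)
    have : IsProbabilityMeasure (P.map V) := Measure.isProbabilityMeasure_map hV.aemeasurable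
    have hFi : ∀ p, Integrable (F p) (((expMeasure lam).prod α).prod (P.map V)) := fun p =>
      Integrable.of_bound (hFm p).aestronglyMeasurable _ (ae_of_all _ (hFb p))
    have hterm : ∀ p ∈ Finset.HasAntidiagonal.antidiagonal k,
        ∫ q, F p q ∂(((expMeasure lam).prod α).prod (P.map V)) =
        lam ^ (n + 1) * Real.exp (-(lam * s)) * k.factorial * s ^ (n + 1 + k) /
          (n + 1 + k).factorial * (e p.1 * b p.2) := by
      intro p hp
      rw [integral_prod _ (hFi p)]
      have h1 : ∀ q : ℝ × ℝ, ∫ z, F p (q, z) ∂(P.map V) = (Set.Ioc 0 s).indicator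
          (fun x => lam ^ n * Real.exp (-(lam * (s - x))) * p.2.factorial *
          b p.2 * (s - x) ^ (n + p.2) / (n + p.2).factorial * (k.choose p.1 * x ^ p.1)) q.1
          * Real.cos q.2 ^ p.1 := by
        intro q
        simp only [F]
        have hms : Measurable fun z => dispPow n p.2 (s - q.1) z :=
          (measurable_dispPow n p.2).comp (f := fun z => (s - q.1, z)) (by fun_prop)
        rw [integral_const_mul, integral_const_mul, integral_map hV.aemeasurable
          hms.aestronglyMeasurable]
        simp only [V]
        rw [ih']
        by_cases h0 : 0 < q.1
        · by_cases h1 : q.1 ≤ s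
          · rw [Set.indicator_of_mem (by exact h0), Set.indicator_of_mem (by simpa using h1),
              Set.indicator_of_mem (by exact ⟨h0, h1⟩)]
            ring
          · rw [Set.indicator_of_notMem (s := Set.Ici 0) (by simpa using h1),
              Set.indicator_of_notMem (s := Set.Ioc 0 s) (by simp [h1])]
            simp
        · rw [Set.indicator_of_notMem (s := Set.Ioi 0) (by simpa using h0),
              Set.indicator_of_notMem (s := Set.Ioc 0 s) (by simp [h0])]
          simp
      simp_rw [h1]
      rw [integral_prod_mul (fun x => (Set.Ioc 0 s).indicator
          (fun x => lam ^ n * Real.exp (-(lam * (s - x))) * p.2.factorial *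
          b p.2 * (s - x) ^ (n + p.2) / (n + p.2).factorial * (k.choose p.1 * x ^ p.1)) x)
          (fun y => Real.cos y ^ p.1), integral_indicator measurableSet_Ioc,
          setIntegral_expMeasure_Ioc lam hlam hs]
      -- The two exponentials multiply to exp(-λs), so only a Beta integral in x remains.
      have h2 : ∀ x : ℝ, lam * Real.exp (-(lam * x)) * (lam ^ n * Real.exp (-(lam * (s - x))) *
          p.2.factorial * b p.2 * (s - x) ^ (n + p.2) / (n + p.2).factorial *
          (k.choose p.1 * x ^ p.1)) = lam ^ (n + 1) * Real.exp (-(lam * s)) * p.2.factorial * b p.2 /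
          (n + p.2).factorial * k.choose p.1 * (x ^ p.1 * (s - x) ^ (n + p.2)) := by
        intro x
        rw [show -(lam * s) = -(lam * x) + -(lam * (s - x)) by ring, Real.exp_add]
        ring
      simp_rw [h2]
      rw [intervalIntegral.integral_const_mul, integral_pow_mul_sub_pow]
      obtain ⟨i, j⟩ := p
      obtain rfl : i + j = k := Finset.HasAntidiagonal.mem_antidiagonal.mp hp
      have hc : (((i + j).choose i : ℕ) : ℝ) * i.factorial * j.factorial = (i + j).factorial := by
        rw [Nat.choose_symm_add]
        exact_mod_cast Nat.add_choose_mul_factorial_mul_factorial i j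
      have e1 : ((n + j).factorial : ℝ) ≠ 0 := by positivity
      simp only
      rw [show i + (n + j) + 1 = n + 1 + (i + j) by ring, ← hc]
      field_simp
      rfl
    calc ∫ ω, dispPow (n + 1) k s (fun i => ξ i ω, fun i => θ i ω) ∂P
        = ∫ ω, H ((ξ 0 ω, θ 0 ω), V ω) ∂P := by
          refine integral_congr_ae (ae_of_all _ fun ω => ?_)
          exact dispPow_succ n k s _ _
      _ = ∫ q, H q ∂(((expMeasure lam).prod α).prod (P.map V)) := by
          rw [← hlaw, integral_map (by fun_prop)
            (Finset.measurable_sum _ fun p _ => hFm p).aestronglyMeasurable]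
      _ = ∑ p ∈ Finset.HasAntidiagonal.antidiagonal k, ∫ q, F p q ∂(((expMeasure lam).prod α).prod (P.map V)) :=
          integral_finsetSum _ fun p _ => hFi p
      _ = _ := by
          -- The antidiagonal sum is a Cauchy product, raising the power of the moment series by
          -- one.
          rw [Finset.sum_congr rfl hterm, ← Finset.mul_sum, pow_succ' (PowerSeries.mk _) (n + 1),
            PowerSeries.coeff_mul]
          simp only [PowerSeries.coeff_mk]
          simp only [e, b]
          ring

end Moments

end RandomMotion

/-! ### Moment determinacy on a compact interval. -/

section MomentDeterminacy

lemma integrable_of_continuous_of_ae_mem_Icc {μ : Measure ℝ} [IsFiniteMeasure μ] {R : ℝ}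
    (hμ : ∀ᵐ x ∂μ, x ∈ Set.Icc (-R) R) {f : ℝ → ℝ} (hf : Continuous f) : Integrable f μ := by
  rw [← Measure.restrict_eq_self_of_ae_mem hμ]
  exact hf.integrableOn_Icc

/-- Finite measures on a compact interval are determined by their moments. -/
theorem ext_of_moments {μ ν : Measure ℝ} [IsFiniteMeasure μ] [IsFiniteMeasure ν] {R : ℝ}
    (hμ : ∀ᵐ x ∂μ, x ∈ Set.Icc (-R) R) (hν : ∀ᵐ x ∂ν, x ∈ Set.Icc (-R) R)
    (h : ∀ k : ℕ, ∫ x, x ^ k ∂μ = ∫ x, x ^ k ∂ν) : μ = ν := by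
  have hpoly : ∀ p : Polynomial ℝ, ∫ x, p.eval x ∂μ = ∫ x, p.eval x ∂ν := by
    intro p
    simp_rw [Polynomial.eval_eq_sum_range]
    rw [integral_finsetSum _ fun i _ => integrable_of_continuous_of_ae_mem_Icc hμ (by fun_prop),
      integral_finsetSum _ fun i _ => integrable_of_continuous_of_ae_mem_Icc hν (by fun_prop)]
    simp_rw [integral_const_mul, h]
  refine ext_of_forall_integral_eq_of_IsFiniteMeasure fun f => ?_
  have hf := f.continuous
  have bound : ∀ (ρ : Measure ℝ) [IsFiniteMeasure ρ], (∀ᵐ x ∂ρ, x ∈ Set.Icc (-R) R) →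
      ∀ (ε : ℝ) (p : Polynomial ℝ), (∀ x ∈ Set.Icc (-R) R, |p.eval x - f x| < ε) →
      |∫ x, p.eval x ∂ρ - ∫ x, f x ∂ρ| ≤ ε * ρ.real Set.univ := by
    intro ρ _ hρ ε p hp
    rw [← integral_sub (integrable_of_continuous_of_ae_mem_Icc hρ p.continuous)
      (integrable_of_continuous_of_ae_mem_Icc hρ hf)]
    rw [← Real.norm_eq_abs]
    refine norm_integral_le_of_norm_le_const (μ := ρ) ?_
    filter_upwards [hρ] with x hx using (hp x hx).le
  by_contra hne
  set d := |∫ x, f x ∂μ - ∫ x, f x ∂ν| with hd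
  have hdpos : 0 < d := abs_pos.mpr (sub_ne_zero.mpr hne)
  set M := μ.real Set.univ + ν.real Set.univ with hM
  have hM0 : 0 ≤ M := by positivity
  -- With this tolerance the total error is at most d M / (M + 1), which is less than d.
  obtain ⟨p, hp⟩ := exists_polynomial_near_of_continuousOn (-R) R f hf.continuousOn
    (d / (M + 1)) (by positivity)
  have h1 := bound μ hμ _ p hp
  have h2 := bound ν hν _ p hp
  rw [hpoly p] at h1
  have h3 : d ≤ d / (M + 1) * M := by
    calc d = |(∫ x, p.eval x ∂ν - ∫ x, f x ∂ν) - (∫ x, p.eval x ∂ν - ∫ x, f x ∂μ)| := by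
          rw [hd]; congr 1; ring
      _ ≤ _ := abs_sub _ _
      _ ≤ d / (M + 1) * ν.real Set.univ + d / (M + 1) * μ.real Set.univ := add_le_add h2 h1
      _ = _ := by rw [hM]; ring
  rw [div_mul_eq_mul_div, le_div_iff₀ (by positivity)] at h3
  linarith

end MomentDeterminacy

/-! ### Arc measures, by the substitution x = R cos φ. -/

namespace RandomMotion

/-- The measure on `(-R, R)` with density `K (R² - x²) ^ ((p - 1) / 2)`. -/
noncomputable def arcMeasure (p : ℕ) (R K : ℝ) : Measure ℝ :=
  (volume.restrict (Set.Ioo (-R) R)).withDensity fun x =>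
    ENNReal.ofReal (K * (R ^ 2 - x ^ 2) ^ (((p : ℝ) - 1) / 2))

lemma image_mul_cos_Ioo {R : ℝ} (hR : 0 < R) :
    (fun φ => R * Real.cos φ) '' Set.Ioo 0 Real.pi = Set.Ioo (-R) R := by
  ext x
  constructor
  · rintro ⟨φ, hφ, rfl⟩
    have h1 : Real.cos φ < 1 := by
      simpa using Real.cos_lt_cos_of_nonneg_of_le_pi le_rfl hφ.2.le hφ.1
    have h2 : -1 < Real.cos φ := by
      simpa using Real.cos_lt_cos_of_nonneg_of_le_pi hφ.1.le le_rfl hφ.2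
    constructor <;> nlinarith
  · intro hx
    have h1 : -1 < x / R := by rw [lt_div_iff₀ hR]; linarith [hx.1]
    have h2 : x / R < 1 := by rw [div_lt_iff₀ hR]; linarith [hx.2]
    refine ⟨Real.arccos (x / R), ⟨Real.arccos_pos.mpr h2, ?_⟩, ?_⟩
    · refine lt_of_le_of_ne (Real.arccos_le_pi _) fun h => ?_
      rw [Real.arccos_eq_pi] at h
      linarith
    · simp only
      rw [Real.cos_arccos h1.le h2.le]
      field_simp

lemma hasDerivWithinAt_mul_cos (R φ : ℝ) (s : Set ℝ) :
    HasDerivWithinAt (fun φ => R * Real.cos φ) (-(R * Real.sin φ)) s φ := by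
  convert! ((Real.hasDerivAt_cos φ).const_mul R).hasDerivWithinAt using 1
  ring

lemma injOn_mul_cos {R : ℝ} (hR : 0 < R) :
    Set.InjOn (fun φ => R * Real.cos φ) (Set.Ioo 0 Real.pi) := fun _ hx _ hy h =>
  Real.injOn_cos (Set.Ioo_subset_Icc_self hx) (Set.Ioo_subset_Icc_self hy)
    (mul_left_cancel₀ hR.ne' h)

/-- As R² - (R cos φ)² = (R sin φ)², the density yields (R sin φ)^(p-1) and the Jacobian the missing
factor. This also covers p = 0, where the density blows up at ±R. -/
lemma abs_deriv_smul_arc (p k : ℕ) {R : ℝ} (hR : 0 < R) (K : ℝ) {φ : ℝ}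
    (hφ : φ ∈ Set.Ioo 0 Real.pi) :
    |(-(R * Real.sin φ))| • (K * (R ^ 2 - (R * Real.cos φ) ^ 2) ^ (((p : ℝ) - 1) / 2) *
      (R * Real.cos φ) ^ k) = K * R ^ (k + p) * (Real.cos φ ^ k * Real.sin φ ^ p) := by
  have hs : 0 < R * Real.sin φ := mul_pos hR (Real.sin_pos_of_mem_Ioo hφ)
  have h1 : R ^ 2 - (R * Real.cos φ) ^ 2 = (R * Real.sin φ) ^ (2 : ℝ) := by
    rw [Real.rpow_two, mul_pow, mul_pow, Real.sin_sq]; ring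
  have h2 : (R * Real.sin φ) * (R * Real.sin φ) ^ ((p : ℝ) - 1) = R ^ p * Real.sin φ ^ p := by
    rw [Real.rpow_sub_one hs.ne', Real.rpow_natCast, mul_div_cancel₀ _ hs.ne', mul_pow]
  rw [abs_neg, abs_of_pos hs, h1, ← Real.rpow_mul hs.le,
    show (2 : ℝ) * (((p : ℝ) - 1) / 2) = p - 1 by ring, smul_eq_mul]
  calc _ = (R * Real.sin φ) * (R * Real.sin φ) ^ ((p : ℝ) - 1) * (K * (R * Real.cos φ) ^ k) := by ring
    _ = _ := by rw [h2]; ring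

lemma integrableOn_arc (p k : ℕ) {R : ℝ} (hR : 0 < R) (K : ℝ) :
    IntegrableOn (fun x => K * (R ^ 2 - x ^ 2) ^ (((p : ℝ) - 1) / 2) * x ^ k) (Set.Ioo (-R) R) := by
  rw [← image_mul_cos_Ioo hR, integrableOn_image_iff_integrableOn_abs_deriv_smul measurableSet_Ioo
    (fun φ _ => hasDerivWithinAt_mul_cos R φ _) (injOn_mul_cos hR)]
  refine IntegrableOn.congr_fun ?_ (fun φ hφ => (abs_deriv_smul_arc p k hR K hφ).symm)
    measurableSet_Ioo
  exact (Continuous.integrableOn_Icc (by fun_prop)).mono_set Set.Ioo_subset_Icc_self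

lemma isFiniteMeasure_arcMeasure (p : ℕ) {R : ℝ} (hR : 0 < R) (K : ℝ) :
    IsFiniteMeasure (arcMeasure p R K) := by
  refine isFiniteMeasure_withDensity_ofReal ?_
  simpa using (integrableOn_arc p 0 hR K).2

lemma ae_arcMeasure_mem (p : ℕ) (R K : ℝ) : ∀ᵐ x ∂arcMeasure p R K, x ∈ Set.Ioo (-R) R :=
  (withDensity_absolutelyContinuous _ _).ae_le (ae_restrict_mem measurableSet_Ioo)

lemma integral_pow_arcMeasure (p k : ℕ) {R K : ℝ} (hR : 0 < R) (hK : 0 ≤ K) :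
    ∫ x, x ^ k ∂arcMeasure p R K = K * R ^ (k + p) * ((∫ φ in (0 : ℝ)..Real.pi, Real.sin φ ^ p) *
      sinMoment p k) := by
  have h1 : ∫ x, x ^ k ∂arcMeasure p R K = ∫ x in Set.Ioo (-R) R,
      K * (R ^ 2 - x ^ 2) ^ (((p : ℝ) - 1) / 2) * x ^ k := by
    rw [arcMeasure, integral_withDensity_eq_integral_toReal_smul (by fun_prop)
      (ae_of_all _ fun _ => by simp)]
    refine setIntegral_congr_fun measurableSet_Ioo fun x hx => ?_
    have : 0 ≤ R ^ 2 - x ^ 2 := by nlinarith [hx.1, hx.2]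
    simp only [smul_eq_mul]
    rw [ENNReal.toReal_ofReal (by positivity)]
  rw [h1]
  nth_rewrite 1 [← image_mul_cos_Ioo hR]
  rw [integral_image_eq_integral_abs_deriv_smul measurableSet_Ioo
    (fun φ _ => hasDerivWithinAt_mul_cos R φ _) (injOn_mul_cos hR),
    setIntegral_congr_fun measurableSet_Ioo fun φ hφ => abs_deriv_smul_arc p k hR K hφ,
    integral_const_mul, ← integral_Ioc_eq_integral_Ioo,
    ← intervalIntegral.integral_of_le Real.pi_pos.le]
  have := (integral_sin_pow_pos (n := p)).ne'
  rw [sinMoment]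
  field_simp

end RandomMotion

/-! ### Normalised arc laws, and the law of the angles. -/

namespace RandomMotion

section ArcLaw

/-- The probability `e ^ (-λ s) (λ s) ^ n / n!` of `n` Poisson events up to time `s`. -/
noncomputable def poissonWeight (lam s : ℝ) (n : ℕ) : ℝ :=
  lam ^ n * Real.exp (-(lam * s)) * s ^ n / n.factorial

lemma poissonWeight_pos {lam s : ℝ} (hlam : 0 < lam) (hs : 0 < s) (n : ℕ) :
    0 < poissonWeight lam s n := by
  unfold poissonWeight
  positivity

lemma hasSum_poissonWeight (lam s : ℝ) : HasSum (poissonWeight lam s) 1 := by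
  have h := (NormedSpace.expSeries_div_hasSum_exp (lam * s)).mul_left (Real.exp (-(lam * s)))
  rw [← Real.exp_eq_exp_ℝ, ← Real.exp_add, neg_add_cancel, Real.exp_zero] at h
  have e : poissonWeight lam s =
      fun n => Real.exp (-(lam * s)) * ((lam * s) ^ n / n.factorial) := by
    funext n
    rw [poissonWeight, mul_pow]
    ring
  rwa [e]

/-- The constant making `(R² - x²) ^ ((p - 1) / 2)` a probability density on `(-R, R)`. -/
noncomputable def arcConst (p : ℕ) (R : ℝ) : ℝ :=
  1 / (R ^ p * ∫ φ in (0 : ℝ)..Real.pi, Real.sin φ ^ p)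

lemma arcConst_pos (p : ℕ) {R : ℝ} (hR : 0 < R) : 0 < arcConst p R := by
  have := integral_sin_pow_pos (n := p)
  unfold arcConst
  positivity

/-- The probability law on `(-R, R)` with density proportional to `(R² - x²) ^ ((p - 1) / 2)`. -/
noncomputable def arcLaw (p : ℕ) (R : ℝ) : Measure ℝ := arcMeasure p R (arcConst p R)

lemma isFiniteMeasure_arcLaw (p : ℕ) {R : ℝ} (hR : 0 < R) : IsFiniteMeasure (arcLaw p R) :=
  isFiniteMeasure_arcMeasure p hR _

lemma ae_arcLaw_mem (p : ℕ) (R : ℝ) : ∀ᵐ x ∂arcLaw p R, x ∈ Set.Icc (-R) R :=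
  (ae_arcMeasure_mem p R _).mono fun _ h => Set.Ioo_subset_Icc_self h

lemma integral_pow_arcLaw (p k : ℕ) {R : ℝ} (hR : 0 < R) :
    ∫ x, x ^ k ∂arcLaw p R = R ^ k * sinMoment p k := by
  have := (integral_sin_pow_pos (n := p)).ne'
  rw [arcLaw, integral_pow_arcMeasure p k hR (arcConst_pos p hR).le, arcConst, pow_add]
  field_simp

lemma arcMeasure_mul (p : ℕ) (R : ℝ) {w : ℝ} (hw : 0 ≤ w) (K : ℝ) :
    arcMeasure p R (w * K) = ENNReal.ofReal w • arcMeasure p R K := by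
  unfold arcMeasure
  rw [← withDensity_smul _ (by fun_prop)]
  congr 1
  ext x
  rw [Pi.smul_apply, smul_eq_mul, ← ENNReal.ofReal_mul hw, mul_assoc]

/-- The scale R enters the k-th moment only as R^k. This scaling is what makes the random clock
tractable. -/
lemma map_mul_arcLaw (p : ℕ) {R r : ℝ} (hR : 0 < R) (hr : 0 < r) :
    (arcLaw p R).map (fun x => x * r) = arcLaw p (R * r) := by
  have := isFiniteMeasure_arcLaw p hR
  have := isFiniteMeasure_arcLaw p (mul_pos hR hr)
  refine ext_of_moments (R := R * r) ?_ (ae_arcLaw_mem p _) fun k => ?_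
  · refine (ae_map_iff (p := (· ∈ Set.Icc _ _)) (by fun_prop) measurableSet_Icc).mpr ?_
    filter_upwards [ae_arcLaw_mem p R] with x hx
    constructor <;> nlinarith [hx.1, hx.2]
  · rw [integral_map (by fun_prop) (by fun_prop), integral_pow_arcLaw p k (mul_pos hR hr)]
    simp_rw [mul_pow]
    rw [integral_mul_const, integral_pow_arcLaw p k hR]
    ring

lemma map_neg_arcLaw (p : ℕ) {R : ℝ} (hR : 0 < R) :
    (arcLaw p R).map (fun x => -x) = arcLaw p R := by
  have := isFiniteMeasure_arcLaw p hR
  refine ext_of_moments (R := R) ?_ (ae_arcLaw_mem p _) fun k => ?_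
  · refine (ae_map_iff (p := (· ∈ Set.Icc _ _)) (by fun_prop) measurableSet_Icc).mpr ?_
    filter_upwards [ae_arcLaw_mem p R] with x hx
    constructor <;> linarith [hx.1, hx.2]
  · rw [integral_map (by fun_prop) (by fun_prop)]
    obtain ⟨j, rfl | rfl⟩ := Nat.even_or_odd' k
    · simp_rw [(even_two_mul j).neg_pow]
    · simp_rw [(odd_two_mul_add_one j).neg_pow]
      rw [integral_neg, integral_pow_arcLaw _ _ hR, sinMoment_odd]
      simp

lemma ae_arcLaw_ne_zero (p : ℕ) (R : ℝ) : ∀ᵐ x ∂arcLaw p R, x ≠ 0 := by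
  refine (withDensity_absolutelyContinuous _ _).ae_le (ae_restrict_of_ae ?_)
  simp [ae_iff]

end ArcLaw

section AngleMeasure

lemma integral_cos_pow_angleMeasure (q k : ℕ) :
    ∫ y, Real.cos y ^ k ∂angleMeasure (q : ℝ) = sinMoment (2 * q) k := by
  have hC : Real.Gamma ((q : ℝ) + 1) / (√Real.pi * Real.Gamma ((q : ℝ) + 1 / 2)) =
      1 / ∫ φ in (0 : ℝ)..Real.pi, Real.sin φ ^ (2 * q) := by
    rw [integral_sin_pow_eq_Gamma, one_div_div]
    push_cast
    congr 3
    · ring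
    · ring
  have hI := integral_sin_pow_pos (n := 2 * q)
  rw [angleMeasure, hC, integral_withDensity_eq_integral_toReal_smul (by fun_prop)
    (ae_of_all _ fun _ => by simp)]
  have : ∀ x ∈ Set.Ioo 0 Real.pi, (ENNReal.ofReal
      (1 / (∫ φ in (0 : ℝ)..Real.pi, Real.sin φ ^ (2 * q)) * Real.sin x ^ (2 * (q : ℝ)))).toReal •
        Real.cos x ^ k = 1 / (∫ φ in (0 : ℝ)..Real.pi, Real.sin φ ^ (2 * q)) *
          (Real.cos x ^ k * Real.sin x ^ (2 * q)) := by
    intro x hx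
    have := Real.sin_pos_of_mem_Ioo hx
    rw [ENNReal.toReal_ofReal (by positivity), smul_eq_mul,
      show (2 * (q : ℝ)) = ((2 * q : ℕ) : ℝ) by push_cast; ring, Real.rpow_natCast]
    ring
  rw [setIntegral_congr_fun measurableSet_Ioo this, integral_const_mul,
    ← integral_Ioc_eq_integral_Ioo, ← intervalIntegral.integral_of_le Real.pi_pos.le, sinMoment]
  ring

lemma mk_integral_cos_pow_angleMeasure (q : ℕ) :
    PowerSeries.mk (fun k => ∫ y, Real.cos y ^ k ∂angleMeasure (q : ℝ)) =
      chooseSeries 0 (sinMoment (2 * q)) := by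
  ext k
  simp [chooseSeries, integral_cos_pow_angleMeasure]

end AngleMeasure

/-! ### Conditional and unconditional law of the position. -/

variable {Ω : Type*}

/-- The event that exactly `n` Poisson events occur up to time `s`. -/
def occEvent (ξ : ℕ → Ω → ℝ) (n : ℕ) (s : ℝ) : Set Ω := {ω | Occurs n s fun i => ξ i ω}

lemma sum_range_le_of_pos {x : ℕ → ℝ} (hx : ∀ i, 0 < x i) {a b : ℕ} (hab : a ≤ b) :
    ∑ i ∈ Finset.range a, x i ≤ ∑ i ∈ Finset.range b, x i :=
  Finset.sum_le_sum_of_subset_of_nonneg (Finset.range_mono hab) fun i _ _ => (hx i).le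

lemma Occurs.eq {n n' : ℕ} {s : ℝ} {x : ℕ → ℝ} (h : Occurs n s x) (h' : Occurs n' s x) : n = n' := by
  have key : ∀ {n n' : ℕ}, Occurs n s x → Occurs n' s x → ¬ n < n' := by
    intro n n' h h' hlt
    have : ∑ i ∈ Finset.range (n + 1), x i ≤ ∑ i ∈ Finset.range n', x i :=
      Finset.sum_le_sum_of_subset_of_nonneg (Finset.range_mono hlt) fun i hi _ =>
        (h'.1 i (Finset.mem_range.mp hi).le).le
    linarith [h.2.2, h'.2.1]
  exact le_antisymm (not_lt.mp (key h' h)) (not_lt.mp (key h h'))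

/-- `count` inspects all arrivals, so positivity is needed beyond index n: it keeps later arrivals
after s. -/
lemma count_eq_of_occurs {ξ : ℕ → Ω → ℝ} {n : ℕ} {s : ℝ} {ω : Ω} (hpos : ∀ i, 0 < ξ i ω)
    (h : Occurs n s fun i => ξ i ω) : count ξ s ω = n := by
  have : {k : ℕ | 1 ≤ k ∧ arrival ξ k ω ≤ s} = Finset.Icc 1 n := by
    ext k
    simp only [Set.mem_ofPred_eq, Finset.coe_Icc, Set.mem_Icc, and_congr_right_iff]
    intro _
    constructor
    · intro hk
      by_contra hlt
      have := sum_range_le_of_pos hpos (a := n + 1) (b := k) (by omega)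
      have h2 := h.2.2
      unfold arrival at hk
      linarith
    · intro hk
      exact (sum_range_le_of_pos hpos hk).trans h.2.1
  rw [count, this, Set.ncard_coe_finset]
  simp

lemma position_eq_of_count {ξ θ : ℕ → Ω → ℝ} {n : ℕ} {s c : ℝ} {ω : Ω} (h : count ξ s ω = n) :
    position c ξ θ s ω = c * displacement n s (fun i => ξ i ω) (fun i => θ i ω) := by
  rw [position, h, displacement, Finset.sum_range_succ]
  congr 2
  · refine Finset.sum_congr rfl fun j hj => ?_
    have := Finset.mem_range.mp hj
    rw [epoch, epoch, if_pos (by omega), if_pos (by omega), arrival, arrival,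
      Finset.sum_range_succ, add_sub_cancel_left]
  -- In the last stretch, `epoch` at n+1 exceeds the count and takes the value s.
  · rw [epoch, epoch, if_neg (by omega), if_pos (by omega), arrival]

lemma pairwise_disjoint_occEvent (ξ : ℕ → Ω → ℝ) (s : ℝ) :
    Pairwise (Function.onFun Disjoint fun n => occEvent ξ n s) := fun i j hij =>
  Set.disjoint_left.mpr fun ω (hi : Occurs i s fun i => ξ i ω) (hj : Occurs j s fun i => ξ i ω) =>
    hij (hi.eq hj)

variable [MeasurableSpace Ω] {P : Measure Ω}

/-- Independent exponential waiting times `ξ` and independent directions `θ` of law `α`, where `α`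
is such that the displacement after `n` changes of direction has an arc law of exponent `p n`. -/
structure IsFlight (P : Measure Ω) (lam : ℝ) (α : Measure ℝ) (p : ℕ → ℕ) (ξ θ : ℕ → Ω → ℝ) :
    Prop where
  measurable_wait : ∀ i, Measurable (ξ i)
  measurable_angle : ∀ j, Measurable (θ j)
  map_wait : ∀ i, P.map (ξ i) = expMeasure lam
  map_angle : ∀ j, P.map (θ j) = α
  indep : iIndepFun (Sum.elim ξ θ) P
  rate_pos : 0 < lam
  pow_series : ∀ n, PowerSeries.mk (fun k => ∫ y, Real.cos y ^ k ∂α) ^ (n + 1) =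
    chooseSeries n (sinMoment (p n))

namespace IsFlight

variable {lam c : ℝ} {α : Measure ℝ} {p : ℕ → ℕ} {ξ θ : ℕ → Ω → ℝ}

lemma measurableSet_occEvent (h : IsFlight P lam α p ξ θ) (n : ℕ) (s : ℝ) :
    MeasurableSet (occEvent ξ n s) := by
  have h1 := h.measurable_wait
  have : Measurable fun ω => ((s, (fun i => ξ i ω), fun _ => 0) : ℝ × (ℕ → ℝ) × (ℕ → ℝ)) := by
    fun_prop
  exact this (measurableSet_occurs n)

lemma measurable_displacement (h : IsFlight P lam α p ξ θ) (n : ℕ) (s : ℝ) :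
    Measurable fun ω => displacement n s (fun i => ξ i ω) (fun i => θ i ω) := by
  have h1 := h.measurable_wait
  have h2 := h.measurable_angle
  exact (RandomMotion.measurable_displacement n).comp
    (f := fun ω => (s, (fun i => ξ i ω), fun i => θ i ω)) (by fun_prop)

lemma ae_pos (h : IsFlight P lam α p ξ θ) : ∀ᵐ ω ∂P, ∀ i, 0 < ξ i ω := by
  rw [ae_all_iff]
  intro i
  have h1 := ae_expMeasure_pos h.rate_pos
  rw [← h.map_wait i] at h1
  exact ae_of_ae_map (h.measurable_wait i).aemeasurable h1

variable [IsProbabilityMeasure P]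

/-- The binomial weight in `chooseSeries` cancels k!/(n+k)! up to 1/n!, leaving the Poisson weight
times an arc moment. The case k = 0 gives the Poisson law of N(s). -/
lemma setIntegral_displacement_pow (h : IsFlight P lam α p ξ θ) (n k : ℕ) {s : ℝ} (hs : 0 ≤ s) :
    ∫ ω in occEvent ξ n s, displacement n s (fun i => ξ i ω) (fun i => θ i ω) ^ k ∂P =
      poissonWeight lam s n * (s ^ k * sinMoment (p n) k) := by
  have h1 := integral_dispPow h.rate_pos n h.measurable_wait h.measurable_angle h.map_wait
    h.map_angle h.indep k hs
  rw [h.pow_series, chooseSeries, PowerSeries.coeff_mk] at h1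
  rw [← integral_indicator (h.measurableSet_occEvent n s)]
  have h2 : ∀ ω, (occEvent ξ n s).indicator
      (fun ω => displacement n s (fun i => ξ i ω) (fun i => θ i ω) ^ k) ω =
      dispPow n k s (fun i => ξ i ω, fun i => θ i ω) := by
    intro ω
    classical
    rw [Set.indicator_apply]
    rfl
  simp_rw [h2]
  rw [h1, poissonWeight, pow_add]
  have h3 : (((n + k).choose n : ℕ) : ℝ) * n.factorial * k.factorial = (n + k).factorial := by
    rw [Nat.choose_symm_add]
    exact_mod_cast Nat.add_choose_mul_factorial_mul_factorial n k
  rw [← h3]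
  have : (((n + k).choose n : ℕ) : ℝ) ≠ 0 := by
    exact_mod_cast (Nat.choose_pos (Nat.le_add_right n k)).ne'
  field_simp

lemma measure_occEvent (h : IsFlight P lam α p ξ θ) (n : ℕ) {s : ℝ} (hs : 0 ≤ s) :
    P (occEvent ξ n s) = ENNReal.ofReal (poissonWeight lam s n) := by
  have := h.setIntegral_displacement_pow n 0 hs
  simp only [pow_zero, sinMoment_zero, mul_one, integral_const, measureReal_restrict_apply_univ,
    smul_eq_mul] at this
  rw [← this, ofReal_measureReal]

lemma map_displacement (h : IsFlight P lam α p ξ θ) (hc : 0 < c) (n : ℕ) {s : ℝ} (hs : 0 < s) :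
    (P.restrict (occEvent ξ n s)).map
      (fun ω => c * displacement n s (fun i => ξ i ω) (fun i => θ i ω)) =
      ENNReal.ofReal (poissonWeight lam s n) • arcLaw (p n) (c * s) := by
  have hcs := mul_pos hc hs
  have := isFiniteMeasure_arcLaw (p n) hcs
  have := (arcLaw (p n) (c * s)).smul_finite (ENNReal.ofReal_ne_top (r := poissonWeight lam s n))
  have hm := (h.measurable_displacement n s).const_mul c
  refine ext_of_moments (R := c * s) ?_ (Measure.ae_smul_measure (ae_arcLaw_mem _ _) _) fun k => ?_
  · refine (ae_map_iff (p := (· ∈ Set.Icc _ _)) hm.aemeasurable measurableSet_Icc).mpr ?_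
    filter_upwards [ae_restrict_mem (h.measurableSet_occEvent n s)] with ω hω
    have := abs_le.mp (hω.abs_displacement_le fun i => θ i ω)
    constructor <;> nlinarith [this.1, this.2]
  · rw [integral_map hm.aemeasurable (by fun_prop)]
    simp_rw [mul_pow]
    rw [integral_const_mul, h.setIntegral_displacement_pow n k hs.le, integral_smul_measure,
      integral_pow_arcLaw _ _ hcs, ENNReal.toReal_ofReal (poissonWeight_pos h.rate_pos hs n).le,
      smul_eq_mul]
    ring

end IsFlight

namespace IsFlight

variable {lam c : ℝ} {α : Measure ℝ} {p : ℕ → ℕ} {ξ θ : ℕ → Ω → ℝ}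

lemma position_ae_eq (h : IsFlight P lam α p ξ θ) (c : ℝ) (n : ℕ) (s : ℝ) :
    position c ξ θ s =ᵐ[P.restrict (occEvent ξ n s)]
      fun ω => c * displacement n s (fun i => ξ i ω) (fun i => θ i ω) := by
  filter_upwards [ae_restrict_mem (h.measurableSet_occEvent n s), ae_restrict_of_ae h.ae_pos]
    with ω h1 h2
  exact position_eq_of_count (count_eq_of_occurs h2 h1)

variable [IsProbabilityMeasure P]

lemma ae_exists_occurs (h : IsFlight P lam α p ξ θ) {s : ℝ} (hs : 0 < s) :
    ∀ᵐ ω ∂P, ω ∈ ⋃ n, occEvent ξ n s := by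
  rw [Filter.eventually_mem_set, mem_ae_iff_prob_eq_one (.iUnion fun n => h.measurableSet_occEvent n s),
    measure_iUnion (pairwise_disjoint_occEvent ξ s)
      (fun n => h.measurableSet_occEvent n s)]
  simp_rw [h.measure_occEvent _ hs.le]
  rw [← ENNReal.ofReal_tsum_of_nonneg (fun n => (poissonWeight_pos h.rate_pos hs n).le)
    (hasSum_poissonWeight lam s).summable, (hasSum_poissonWeight lam s).tsum_eq, ENNReal.ofReal_one]

/-- Almost everywhere only: `ncard` is 0 on infinite sets. Since the Poisson weights sum to 1,
infinitely many arrivals before s form a null event. -/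
lemma count_ae_eq (h : IsFlight P lam α p ξ θ) (n : ℕ) {s : ℝ} (hs : 0 < s) :
    {ω | count ξ s ω = n} =ᵐ[P] occEvent ξ n s := by
  filter_upwards [h.ae_exists_occurs hs, h.ae_pos] with ω h1 h2
  obtain ⟨k, hk⟩ := Set.mem_iUnion.mp h1
  have h3 := count_eq_of_occurs h2 hk
  refine propext ⟨fun h4 => ?_, fun h4 => count_eq_of_occurs h2 h4⟩
  obtain rfl : k = n := h3.symm.trans h4
  exact hk

lemma measure_count (h : IsFlight P lam α p ξ θ) (n : ℕ) {s : ℝ} (hs : 0 < s) :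
    P {ω | count ξ s ω = n} = ENNReal.ofReal (poissonWeight lam s n) := by
  rw [measure_congr (h.count_ae_eq n hs), h.measure_occEvent n hs.le]

lemma eq_sum_restrict (h : IsFlight P lam α p ξ θ) {s : ℝ} (hs : 0 < s) :
    Measure.sum (fun n => P.restrict (occEvent ξ n s)) = P := by
  rw [← Measure.restrict_iUnion
    (pairwise_disjoint_occEvent ξ s)
    (fun n => h.measurableSet_occEvent n s), Measure.restrict_eq_self_of_ae_mem (h.ae_exists_occurs hs)]

lemma aemeasurable_position (h : IsFlight P lam α p ξ θ) (c : ℝ) {s : ℝ} (hs : 0 < s) :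
    AEMeasurable (position c ξ θ s) P := by
  rw [← h.eq_sum_restrict hs]
  refine AEMeasurable.sum_measure fun n => ?_
  exact ((h.measurable_displacement n s).const_mul c).aemeasurable.congr
    (h.position_ae_eq c n s).symm

lemma map_position_restrict (h : IsFlight P lam α p ξ θ) (hc : 0 < c) (n : ℕ) {s : ℝ} (hs : 0 < s) :
    (P.restrict (occEvent ξ n s)).map (position c ξ θ s) =
      ENNReal.ofReal (poissonWeight lam s n) • arcLaw (p n) (c * s) := by
  rw [Measure.map_congr (h.position_ae_eq c n s), h.map_displacement hc n hs]

lemma map_position (h : IsFlight P lam α p ξ θ) (hc : 0 < c) {s : ℝ} (hs : 0 < s) :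
    P.map (position c ξ θ s) =
      Measure.sum fun n => ENNReal.ofReal (poissonWeight lam s n) • arcLaw (p n) (c * s) := by
  have hm := h.aemeasurable_position c hs
  rw [← h.eq_sum_restrict hs] at hm
  conv_lhs => rw [← h.eq_sum_restrict hs]
  rw [Measure.map_sum hm]
  simp_rw [h.map_position_restrict hc _ hs]

lemma condLaw_eq (h : IsFlight P lam α p ξ θ) (hc : 0 < c) (n : ℕ) {s : ℝ} (hs : 0 < s) :
    condLaw P c ξ θ n s = arcLaw (p n) (c * s) := by
  have hw := poissonWeight_pos h.rate_pos hs n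
  rw [condLaw, ProbabilityTheory.cond, Measure.map_smul, h.measure_count n hs,
    Measure.restrict_congr_set (h.count_ae_eq n hs), h.map_position_restrict hc n hs, smul_smul,
    ENNReal.inv_mul_cancel (by simpa using hw) (by simp), one_smul]

end IsFlight

end RandomMotion

/-! ### Exponential scaling and Laplace mixtures. -/

namespace RandomMotion

section Laplace

lemma image_mul_left_Ioi_zero {y : ℝ} (hy : y ≠ 0) :
    (fun s => y * s) '' Set.Ioi 0 = if 0 < y then Set.Ioi (0 : ℝ) else Set.Iio 0 := by
  ext z
  split_ifs with h
  · refine ⟨?_, fun hz => ⟨z / y, div_pos hz h, by field_simp⟩⟩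
    rintro ⟨s, hs, rfl⟩
    exact mul_pos h hs
  · have h : y < 0 := lt_of_le_of_ne (not_lt.mp h) hy
    refine ⟨?_, fun hz => ⟨z / y, div_pos_of_neg_of_neg hz h, by field_simp⟩⟩
    rintro ⟨s, hs, rfl⟩
    exact mul_neg_of_neg_of_pos h hs

lemma expMeasure_preimage_mul {t y : ℝ} (ht : 0 < t) (hy : y ≠ 0) {A : Set ℝ}
    (hA : MeasurableSet A) :
    expMeasure t {s | y * s ∈ A} = ∫⁻ z in (fun s => y * s) '' Set.Ioi 0, A.indicator
      (fun z => ENNReal.ofReal (t / |y| * Real.exp (-(t / |y| * |z|)))) z := by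
  have hS : MeasurableSet {s | y * s ∈ A} := (measurable_const_mul y) hA
  have hy' : 0 < |y| := abs_pos.mpr hy
  have hder : ∀ s : ℝ, HasDerivWithinAt (fun s => y * s) y (Set.Ioi 0) s := fun s => by
    simpa using ((hasDerivAt_id s).const_mul y).hasDerivWithinAt
  rw [lintegral_image_eq_lintegral_abs_deriv_mul measurableSet_Ioi (fun s _ => hder s)
    (mul_right_injective₀ hy).injOn, ← Measure.restrict_eq_self_of_ae_mem (s := Set.Ioi 0)
    (ae_expMeasure_pos ht), Measure.restrict_apply hS]
  have : expMeasure t = volume.withDensity fun x => ENNReal.ofReal (exponentialPDFReal t x) := rfl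
  rw [this, withDensity_apply _ (hS.inter measurableSet_Ioi), ← Measure.restrict_restrict hS,
    ← lintegral_indicator hS]
  refine setLIntegral_congr_fun measurableSet_Ioi fun s hs => ?_
  have hs : 0 < s := hs
  by_cases h : y * s ∈ A
  · rw [Set.indicator_of_mem (by exact h), Set.indicator_of_mem h,
      ← ENNReal.ofReal_mul (abs_nonneg y)]
    congr 1
    simp only [exponentialPDFReal, gammaPDFReal, hs.le, if_true]
    rw [abs_mul, abs_of_pos hs]
    simp
    field_simp
  · rw [Set.indicator_of_notMem (by exact h), Set.indicator_of_notMem h, mul_zero]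

lemma laplaceMeasure_zero : laplaceMeasure 0 = 0 := by
  simp [laplaceMeasure]

/-- A Laplace variable is an exponential variable with a random sign. -/
lemma laplaceMeasure_apply_eq {t x : ℝ} (ht : 0 < t) (hx : x ≠ 0) {A : Set ℝ}
    (hA : MeasurableSet A) :
    laplaceMeasure (t ^ 2 / |x|) A = 2⁻¹ * (expMeasure t {s | x * (s / t) ∈ A} +
      expMeasure t {s | -x * (s / t) ∈ A}) := by
  have e1 : ∀ x : ℝ, {s | x * (s / t) ∈ A} = {s | (x / t) * s ∈ A} := by
    intro x
    ext s
    simp only [Set.mem_ofPred_eq]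
    rw [mul_div_assoc', div_mul_eq_mul_div]
  have hy : x / t ≠ 0 := div_ne_zero hx ht.ne'
  have hr : t / |x / t| = t ^ 2 / |x| := by
    rw [abs_div, abs_of_pos ht]
    field_simp
  have hr' : t / |-x / t| = t ^ 2 / |x| := by
    rw [neg_div, abs_neg, hr]
  rw [e1, e1, expMeasure_preimage_mul ht hy hA,
    expMeasure_preimage_mul ht (by rw [neg_div]; exact neg_ne_zero.mpr hy) hA, hr, hr']
  set r := t ^ 2 / |x| with hrdef
  set g : ℝ → ℝ≥0∞ := A.indicator (fun z => ENNReal.ofReal (r * Real.exp (-(r * |z|)))) with hg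
  have hgm : Measurable g := Measurable.indicator (by fun_prop) hA
  have hsum : (∫⁻ z in (fun s => x / t * s) '' Set.Ioi 0, g z) +
      ∫⁻ z in (fun s => -x / t * s) '' Set.Ioi 0, g z = ∫⁻ z, g z := by
    have key : (∫⁻ z in Set.Ioi 0, g z) + ∫⁻ z in Set.Iio 0, g z = ∫⁻ z, g z := by
      rw [setLIntegral_congr (Iio_ae_eq_Iic (a := (0 : ℝ))), ← Set.compl_Ioi,
        lintegral_add_compl g measurableSet_Ioi]
    rw [image_mul_left_Ioi_zero hy, image_mul_left_Ioi_zero (by rw [neg_div]; exact neg_ne_zero.mpr hy)]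
    rcases lt_or_gt_of_ne hx with h | h
    · have h1 : x / t < 0 := div_neg_of_neg_of_pos h ht
      have h2 : 0 < -x / t := div_pos (neg_pos.mpr h) ht
      rw [if_neg h1.not_gt, if_pos h2, add_comm, key]
    · have h1 : 0 < x / t := div_pos h ht
      have h2 : -x / t < 0 := div_neg_of_neg_of_pos (neg_lt_zero.mpr h) ht
      rw [if_pos h1, if_neg h2.not_gt, key]
  rw [hsum, ← lintegral_const_mul _ hgm, laplaceMeasure, withDensity_apply _ hA,
    ← lintegral_indicator hA]
  congr 1
  ext z
  by_cases hz : z ∈ A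
  · rw [hg, Set.indicator_of_mem hz, Set.indicator_of_mem hz,
      show (2⁻¹ : ℝ≥0∞) = ENNReal.ofReal 2⁻¹ by
        rw [ENNReal.ofReal_inv_of_pos (by norm_num)]; simp,
      ← ENNReal.ofReal_mul (by norm_num)]
    congr 1
    ring
  · rw [hg, Set.indicator_of_notMem hz, Set.indicator_of_notMem hz, mul_zero]

lemma measurableSet_scaled (t : ℝ) {A : Set ℝ} (hA : MeasurableSet A) :
    MeasurableSet {q : ℝ × ℝ | q.1 * (q.2 / t) ∈ A} :=
  (show Measurable fun q : ℝ × ℝ => q.1 * (q.2 / t) by fun_prop) hA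

lemma measurable_expMeasure_scaled {t : ℝ} (ht : 0 < t) {A : Set ℝ} (hA : MeasurableSet A) :
    Measurable fun x : ℝ => expMeasure t {s | x * (s / t) ∈ A} := by
  have := isProbabilityMeasure_expMeasure ht
  exact measurable_measure_prodMk_left (measurableSet_scaled t hA)

/-- Measurability is read off the exponential representation. At x = 0 the rate t²/|x| is 0 by
convention and the measure is zero. -/
lemma measurable_laplaceMeasure_apply {t : ℝ} (ht : 0 < t) {A : Set ℝ} (hA : MeasurableSet A) :
    Measurable fun x : ℝ => laplaceMeasure (t ^ 2 / |x|) A := by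
  have hF := measurable_expMeasure_scaled ht hA
  have : (fun x : ℝ => laplaceMeasure (t ^ 2 / |x|) A) = fun x => if x = 0 then 0 else
      2⁻¹ * (expMeasure t {s | x * (s / t) ∈ A} + expMeasure t {s | -x * (s / t) ∈ A}) := by
    ext x
    split_ifs with hx
    · simp [hx, laplaceMeasure_zero]
    · exact laplaceMeasure_apply_eq ht hx hA
  rw [this]
  exact Measurable.ite (measurableSet_singleton 0) measurable_const
    ((hF.add (hF.comp measurable_neg)).const_mul _)

/-- A symmetric law scaled by an exponential variable is a mixture of Laplace laws. -/
lemma lintegral_laplaceMeasure_of_symm {t : ℝ} (ht : 0 < t) {ρ : Measure ℝ}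
    (hsymm : ρ.map (fun x => -x) = ρ) (h0 : ∀ᵐ x ∂ρ, x ≠ 0) {A : Set ℝ} (hA : MeasurableSet A) :
    ∫⁻ x, laplaceMeasure (t ^ 2 / |x|) A ∂ρ = ∫⁻ x, expMeasure t {s | x * (s / t) ∈ A} ∂ρ := by
  have hF := measurable_expMeasure_scaled ht hA
  have h1 : ∫⁻ x, expMeasure t {s | -x * (s / t) ∈ A} ∂ρ =
      ∫⁻ x, expMeasure t {s | x * (s / t) ∈ A} ∂ρ := by
    conv_rhs => rw [← hsymm]
    rw [lintegral_map hF measurable_neg]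
  have hG : Measurable fun x : ℝ =>
      expMeasure t {s | x * (s / t) ∈ A} + expMeasure t {s | -x * (s / t) ∈ A} :=
    hF.add (hF.comp measurable_neg)
  rw [lintegral_congr_ae (h0.mono fun x hx => laplaceMeasure_apply_eq ht hx hA),
    lintegral_const_mul _ hG, lintegral_add_left hF, h1, ← two_mul,
    ← mul_assoc, ENNReal.inv_mul_cancel (by norm_num) (by norm_num), one_mul]

end Laplace

/-! ### The random clock, and densities as series. -/

/-- The density of the displacement on the event of `n` changes of direction. -/
noncomputable def flightTerm (p : ℕ → ℕ) (lam c t : ℝ) (n : ℕ) (x : ℝ) : ℝ :=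
  poissonWeight lam t n * arcConst (p n) (c * t) *
    ((c * t) ^ 2 - x ^ 2) ^ (((p n : ℝ) - 1) / 2)

variable {Ω : Type*} [MeasurableSpace Ω] {P : Measure Ω}

namespace IsFlight

variable {lam c : ℝ} {α : Measure ℝ} {p : ℕ → ℕ} {ξ θ : ℕ → Ω → ℝ}

lemma flightTerm_nonneg (h : IsFlight P lam α p ξ θ) (hc : 0 < c) {t : ℝ} (ht : 0 < t) (n : ℕ)
    {x : ℝ} (hx : x ∈ Set.Ioo (-(c * t)) (c * t)) : 0 ≤ flightTerm p lam c t n x := by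
  have h1 := poissonWeight_pos h.rate_pos ht n
  have h2 := arcConst_pos (p n) (mul_pos hc ht)
  have h3 : 0 ≤ (c * t) ^ 2 - x ^ 2 := by nlinarith [hx.1, hx.2]
  unfold flightTerm
  positivity

variable [IsProbabilityMeasure P]

lemma condClockLaw_apply (h : IsFlight P lam α p ξ θ) (hc : 0 < c) (n : ℕ) {t : ℝ} (ht : 0 < t)
    {A : Set ℝ} (hA : MeasurableSet A) :
    condClockLaw P c ξ θ (expMeasure t) n A =
      ∫⁻ x, laplaceMeasure (t ^ 2 / |x|) A ∂arcLaw (p n) (c * t) := by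
  have hct := mul_pos hc ht
  have := isProbabilityMeasure_expMeasure ht
  have := isFiniteMeasure_arcLaw (p n) hct
  -- The conditional law at time s is the one at time t dilated by s/t. This version of the kernel
  -- is measurable in s, which `Measure.bind_apply` requires; Fubini then exchanges clock and
  -- position.
  have hae : condLaw P c ξ θ n =ᵐ[expMeasure t]
      fun s => (arcLaw (p n) (c * t)).map fun x => x * (s / t) := by
    filter_upwards [ae_expMeasure_pos ht] with s hs
    rw [h.condLaw_eq hc n hs, map_mul_arcLaw (p n) hct (div_pos hs ht)]
    congr 1
    field_simp
  have happ : ∀ s, ∀ B : Set ℝ, MeasurableSet B →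
      (arcLaw (p n) (c * t)).map (fun x => x * (s / t)) B =
        arcLaw (p n) (c * t) ((fun x => (x, s)) ⁻¹' {q : ℝ × ℝ | q.1 * (q.2 / t) ∈ B}) :=
    fun s B hB => Measure.map_apply (by fun_prop) hB
  have hmeas : Measurable fun s => (arcLaw (p n) (c * t)).map fun x => x * (s / t) := by
    refine Measure.measurable_of_measurable_coe _ fun B hB => ?_
    simp_rw [happ _ B hB]
    exact measurable_measure_prodMk_right (measurableSet_scaled t hB)
  rw [condClockLaw, Measure.bind_apply hA (hmeas.aemeasurable.congr hae.symm),
    lintegral_congr_ae (hae.mono fun s hs => by rw [hs, happ s A hA]),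
    ← Measure.prod_apply_symm (measurableSet_scaled t hA),
    Measure.prod_apply (measurableSet_scaled t hA),
    lintegral_laplaceMeasure_of_symm ht (map_neg_arcLaw _ hct) (ae_arcLaw_ne_zero _ _) hA]
  rfl

lemma clockLaw_apply (h : IsFlight P lam α p ξ θ) (hc : 0 < c) {t : ℝ} (ht : 0 < t)
    {A : Set ℝ} (hA : MeasurableSet A) :
    clockLaw P c ξ θ (expMeasure t) t A =
      ∫⁻ x, laplaceMeasure (t ^ 2 / |x|) A ∂P.map (position c ξ θ t) := by
  rw [clockLaw, Measure.sum_apply _ hA, h.map_position hc ht, lintegral_sum_measure]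
  refine tsum_congr fun n => ?_
  rw [Measure.smul_apply, lintegral_smul_measure, h.measure_count n ht,
    h.condClockLaw_apply hc n ht hA]

lemma map_position_eq_withDensity (h : IsFlight P lam α p ξ θ) (hc : 0 < c) {t : ℝ} (ht : 0 < t) :
    P.map (position c ξ θ t) = (volume.restrict (Set.Ioo (-(c * t)) (c * t))).withDensity
      fun x => ∑' n, ENNReal.ofReal (flightTerm p lam c t n x) := by
  have e : (fun x => ∑' n, ENNReal.ofReal (flightTerm p lam c t n x)) =
      ∑' n, fun x => ENNReal.ofReal (flightTerm p lam c t n x) := by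
    ext x
    rw [ENNReal.tsum_apply]
  rw [h.map_position hc ht, e, withDensity_tsum (by unfold flightTerm; fun_prop)]
  congr 1
  ext1 n
  rw [arcLaw, ← arcMeasure_mul _ _ (poissonWeight_pos h.rate_pos ht n).le]
  rfl

/-- The total mass is finite, so the extended series is finite almost everywhere. There the real
series is summable, and its `tsum` is not the default value 0. -/
lemma ae_tsum_flightTerm (h : IsFlight P lam α p ξ θ) (hc : 0 < c) {t : ℝ} (ht : 0 < t) :
    ∀ᵐ x ∂volume.restrict (Set.Ioo (-(c * t)) (c * t)),
      ∑' n, ENNReal.ofReal (flightTerm p lam c t n x) =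
        ENNReal.ofReal (∑' n, flightTerm p lam c t n x) := by
  have hm : Measurable fun x => ∑' n, ENNReal.ofReal (flightTerm p lam c t n x) :=
    Measurable.tsum fun n => by unfold flightTerm; fun_prop
  have h1 : ∫⁻ x in Set.Ioo (-(c * t)) (c * t),
      ∑' n, ENNReal.ofReal (flightTerm p lam c t n x) ≠ ∞ := by
    have := congrArg (fun μ : Measure ℝ => μ Set.univ) (h.map_position_eq_withDensity hc ht)
    simp only [withDensity_apply _ MeasurableSet.univ, Measure.restrict_univ] at this
    rw [← this]
    have := Measure.isProbabilityMeasure_map (h.aemeasurable_position c ht)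
    exact measure_ne_top _ _
  filter_upwards [ae_lt_top hm h1, ae_restrict_mem measurableSet_Ioo] with x hx hxI
  have h0 := fun n => h.flightTerm_nonneg hc ht n hxI
  have hs := ENNReal.summable_toReal hx.ne
  simp_rw [fun n => ENNReal.toReal_ofReal (h0 n)] at hs
  exact (ENNReal.ofReal_tsum_of_nonneg h0 hs).symm

end IsFlight

lemma lintegral_Ioo_neg_eq_two_mul {f : ℝ → ℝ≥0∞} (hf : Measurable f) (heven : ∀ x, f (-x) = f x)
    {R : ℝ} (hR : 0 < R) :
    ∫⁻ x in Set.Ioo (-R) R, f x = 2 * ∫⁻ x in Set.Ioo 0 R, f x := by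
  have h1 : ∫⁻ x in Set.Ioo (-R) 0, f x = ∫⁻ x in Set.Ioo 0 R, f x := by
    have := (Measure.measurePreserving_neg (volume : Measure ℝ)).setLIntegral_comp_preimage
      (measurableSet_Ioo (a := (-R)) (b := 0)) hf
    rw [← this]
    simp [heven]
  rw [← Set.Ioo_union_Ico_eq_Ioo (neg_lt_zero.mpr hR) hR.le,
    lintegral_union measurableSet_Ico (Set.disjoint_left.mpr fun x hx hx' => hx'.1.not_gt hx.2), h1,
    setLIntegral_congr Ioo_ae_eq_Ico.symm, two_mul]

/-- The mixture of Laplace laws over an even density. -/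
lemma lintegral_laplaceMeasure_withDensity {t R : ℝ} (hR : 0 < R) (ht : 0 < t)
    {f : ℝ → ℝ≥0∞} (hf : Measurable f) (heven : ∀ x, f (-x) = f x) {A : Set ℝ}
    (hA : MeasurableSet A) :
    ∫⁻ x, laplaceMeasure (t ^ 2 / |x|) A ∂(volume.restrict (Set.Ioo (-R) R)).withDensity f =
      volume.withDensity (fun x => ∫⁻ y in Set.Ioo 0 R,
        ENNReal.ofReal (t ^ 2 / (2 * y) * Real.exp (-(t ^ 2 * |x| / y))) * (2 * f y)) A := by
  have hL := measurable_laplaceMeasure_apply ht hA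
  rw [lintegral_withDensity_eq_lintegral_mul _ hf hL, withDensity_apply _ hA,
    lintegral_lintegral_swap (by fun_prop)]
  simp only [Pi.mul_apply]
  have hfL : Measurable fun x => f x * laplaceMeasure (t ^ 2 / |x|) A := hf.mul hL
  -- Folding onto (0, R) produces the factor 2 in front of the density.
  rw [lintegral_Ioo_neg_eq_two_mul hfL (fun x => by rw [heven, abs_neg]) hR,
    ← lintegral_const_mul _ hfL]
  refine setLIntegral_congr_fun measurableSet_Ioo fun y hy => ?_
  have hy : 0 < y := hy.1
  have hlap : laplaceMeasure (t ^ 2 / |y|) A =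
      ∫⁻ x in A, ENNReal.ofReal (t ^ 2 / (2 * y) * Real.exp (-(t ^ 2 * |x| / y))) := by
    rw [laplaceMeasure, withDensity_apply _ hA, abs_of_pos hy]
    congr 1
    ext x
    rw [show t ^ 2 / y / 2 = t ^ 2 / (2 * y) by field_simp,
      show t ^ 2 / y * |x| = t ^ 2 * |x| / y by ring]
  rw [lintegral_mul_const _ (by fun_prop), hlap]
  ring

end RandomMotion

/-! ### Identification of the series with p⁰ and p¹. -/

namespace RandomMotion

/-- The exponent of the arc law after `n` changes of direction for the angle law of index `m`. -/
def arcExponent (m : Fin 2) (n : ℕ) : ℕ := if m = 0 then n else 2 * n + 2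

lemma mk_integral_cos_pow_pow (m : Fin 2) (n : ℕ) :
    PowerSeries.mk (fun k => ∫ y, Real.cos y ^ k ∂angleMeasure ((m : ℕ) : ℝ)) ^ (n + 1) =
      chooseSeries n (sinMoment (arcExponent m n)) := by
  rw [mk_integral_cos_pow_angleMeasure]
  fin_cases m
  · exact chooseSeries_sinMoment_pow n
  · exact chooseSeries_sinMoment_two_pow n

/-- Legendre duplication. It turns the ratio of Gamma values in `arcConst` into n!/Γ((n+1)/2)² up to
powers, and n! cancels with the Poisson weight. -/
lemma Gamma_half_mul_Gamma (n : ℕ) :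
    Real.Gamma (((n : ℝ) + 1) / 2) * Real.Gamma ((n : ℝ) / 2 + 1) =
      n.factorial * √Real.pi / 2 ^ n := by
  have h := Real.Gamma_mul_Gamma_add_half (((n : ℝ) + 1) / 2)
  rw [show ((n : ℝ) + 1) / 2 + 1 / 2 = n / 2 + 1 by ring,
    show 2 * (((n : ℝ) + 1) / 2) = n + 1 by ring, Real.Gamma_nat_eq_factorial,
    show 1 - ((n : ℝ) + 1) = -(n : ℝ) by ring, Real.rpow_neg (by norm_num), Real.rpow_natCast] at h
  rw [h]
  ring

lemma flightTerm_arcExponent_zero {c lam x t : ℝ} (hc : 0 < c) (hlam : 0 < lam) (ht : 0 < t)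
    (hx : 0 < c ^ 2 * t ^ 2 - x ^ 2) (n : ℕ) :
    flightTerm (arcExponent 0) lam c t n x = lam * Real.exp (-(lam * t)) / (2 * c) *
      ((lam / (2 * c) * √(c ^ 2 * t ^ 2 - x ^ 2)) ^ ((n : ℤ) - 1) *
        (1 / Real.Gamma (((n : ℝ) + 1) / 2) ^ 2)) := by
  have hu : 0 < √(c ^ 2 * t ^ 2 - x ^ 2) := Real.sqrt_pos.mpr hx
  have hw : (c * t) ^ 2 - x ^ 2 = √(c ^ 2 * t ^ 2 - x ^ 2) ^ (2 : ℝ) := by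
    rw [Real.rpow_two, Real.sq_sqrt hx.le]
    ring
  have hG := Gamma_half_mul_Gamma n
  have hG1 : 0 < Real.Gamma (((n : ℝ) + 1) / 2) := Real.Gamma_pos_of_pos (by positivity)
  have hG2 : 0 < Real.Gamma ((n : ℝ) / 2 + 1) := Real.Gamma_pos_of_pos (by positivity)
  have hpi : 0 < √Real.pi := Real.sqrt_pos.mpr Real.pi_pos
  simp only [flightTerm, arcExponent, if_true, arcConst, poissonWeight]
  rw [hw, ← Real.rpow_mul hu.le, show 2 * (((n : ℝ) - 1) / 2) = n - 1 by ring,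
    Real.rpow_sub_one hu.ne', Real.rpow_natCast, zpow_sub_one₀ (by positivity), zpow_natCast,
    integral_sin_pow_eq_Gamma]
  set u := √(c ^ 2 * t ^ 2 - x ^ 2)
  set G1 := Real.Gamma (((n : ℝ) + 1) / 2)
  set G2 := Real.Gamma ((n : ℝ) / 2 + 1)
  have hG2' : G2 = n.factorial * √Real.pi / 2 ^ n / G1 := by
    rw [eq_div_iff hG1.ne', mul_comm, hG]
  rw [hG2', mul_pow c t, mul_pow _ u, div_pow, mul_pow 2 c]
  field_simp

/-- The factor n+1 is (n+1)!/n!: the numerator comes from the arc normalisation with p = 2n+2, the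
denominator from the Poisson weight. -/
lemma flightTerm_arcExponent_one {c lam x t : ℝ} (hc : 0 < c) (hlam : 0 < lam) (ht : 0 < t)
    (hx : 0 < c ^ 2 * t ^ 2 - x ^ 2) (n : ℕ) :
    flightTerm (arcExponent 1) lam c t n x =
      Real.exp (-(lam * t)) / (c * √(lam * Real.pi * t ^ 3)) *
        ((lam / (c ^ 2 * t) * (c ^ 2 * t ^ 2 - x ^ 2)) ^ ((n : ℝ) + 1 / 2) *
          (((n : ℝ) + 1) / Real.Gamma ((n : ℝ) + 3 / 2))) := by
  have hw : (c * t) ^ 2 - x ^ 2 = c ^ 2 * t ^ 2 - x ^ 2 := by ring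
  have hI : (∫ φ in (0 : ℝ)..Real.pi, Real.sin φ ^ (2 * n + 2)) =
      √Real.pi * Real.Gamma ((n : ℝ) + 3 / 2) / (n + 1).factorial := by
    rw [integral_sin_pow_eq_Gamma, ← Real.Gamma_nat_eq_factorial]
    push_cast
    congr 3 <;> ring
  have hG : 0 < Real.Gamma ((n : ℝ) + 3 / 2) := Real.Gamma_pos_of_pos (by positivity)
  have hpi : 0 < √Real.pi := Real.sqrt_pos.mpr Real.pi_pos
  have hsl : 0 < √lam := Real.sqrt_pos.mpr hlam
  have hst : 0 < √t := Real.sqrt_pos.mpr ht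
  have e1 : √(lam * Real.pi * t ^ 3) = √lam * √Real.pi * (t * √t) := by
    rw [Real.sqrt_mul (by positivity), Real.sqrt_mul hlam.le, show t ^ 3 = t ^ 2 * t by ring,
      Real.sqrt_mul (by positivity), Real.sqrt_sq ht.le]
  have e2 : (lam / (c ^ 2 * t)) ^ ((n : ℝ) + 1 / 2) =
      (lam / (c ^ 2 * t)) ^ n * (√lam / (c * √t)) := by
    rw [Real.rpow_add (by positivity), Real.rpow_natCast, ← Real.sqrt_eq_rpow,
      Real.sqrt_div hlam.le, Real.sqrt_mul (by positivity), Real.sqrt_sq hc.le]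
  have e3 : (((2 * n + 2 : ℕ) : ℝ) - 1) / 2 = n + 1 / 2 := by
    push_cast
    ring
  simp only [flightTerm, arcExponent, one_ne_zero, if_false, arcConst, poissonWeight]
  rw [hw, e3, Real.mul_rpow (by positivity) hx.le, e2, e1, hI, Nat.factorial_succ]
  set W := (c ^ 2 * t ^ 2 - x ^ 2) ^ ((n : ℝ) + 1 / 2)
  have ht2 : √t * √t = t := Real.mul_self_sqrt ht.le
  rw [show Real.exp (-(lam * t)) / (c * (√lam * √Real.pi * (t * √t))) *
      ((lam / (c ^ 2 * t)) ^ n * (√lam / (c * √t)) * W * (((n : ℝ) + 1) /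
        Real.Gamma ((n : ℝ) + 3 / 2))) = Real.exp (-(lam * t)) / (c * (√Real.pi * t * (√t * √t))) *
      ((lam / (c ^ 2 * t)) ^ n * (1 / c) * W * (((n : ℝ) + 1) / Real.Gamma ((n : ℝ) + 3 / 2))) by
    field_simp, ht2, div_pow, mul_pow, mul_pow, ← pow_mul]
  push_cast
  field_simp
  ring

lemma density_eq_tsum (m : Fin 2) {c lam x t : ℝ} (hc : 0 < c) (hlam : 0 < lam) (ht : 0 < t)
    (hx : x ∈ Set.Ioo (-(c * t)) (c * t)) :
    density m c lam x t = ∑' n, flightTerm (arcExponent m) lam c t n x := by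
  have hx' : 0 < c ^ 2 * t ^ 2 - x ^ 2 := by nlinarith [hx.1, hx.2]
  fin_cases m
  · simp only [density, density₀, Fin.zero_eta, if_true, ← tsum_mul_left]
    exact tsum_congr fun n => (flightTerm_arcExponent_zero hc hlam ht hx' n).symm
  · simp only [density, density₁, Fin.mk_one, one_ne_zero, if_false, ← tsum_mul_left]
    exact tsum_congr fun n => (flightTerm_arcExponent_one hc hlam ht hx' n).symm


end RandomMotion

theorem theorem9 {Ω : Type*} [MeasurableSpace Ω] (P : Measure Ω) [IsProbabilityMeasure P]
    (m : Fin 2) (c lam t : ℝ) (hc : 0 < c) (hlam : 0 < lam) (ht : 0 < t)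
    (ξ θ : ℕ → Ω → ℝ)
    (hξ_meas : ∀ i, Measurable (ξ i)) (hθ_meas : ∀ j, Measurable (θ j))
    (hξ_law : ∀ i, P.map (ξ i) = expMeasure lam)
    (hθ_law : ∀ j, P.map (θ j) = RandomMotion.angleMeasure ((m : ℕ) : ℝ))
    (h_indep : iIndepFun (Sum.elim ξ θ) P) :
    -- the function `pᵐ(·, t)` is the density of `X_m(t)`
    P.map (RandomMotion.position c ξ θ t) =
        (volume.restrict (Set.Ioo (-(c * t)) (c * t))).withDensity
          (fun x => ENNReal.ofReal (RandomMotion.density m c lam x t)) ∧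
    -- the density of `X_m(G_1(t))`
    RandomMotion.clockLaw P c ξ θ (gammaMeasure 1 t) t =
        volume.withDensity (fun x => ∫⁻ y in Set.Ioo 0 (c * t),
          ENNReal.ofReal (t ^ 2 / (2 * y) * Real.exp (-(t ^ 2 * |x| / y)) *
            (2 * RandomMotion.density m c lam y t))) ∧
    -- `X_m(G_1(t))` is a Laplace variable with random parameter `t² / |X_m(t)|`
    ∀ A : Set ℝ, MeasurableSet A →
      RandomMotion.clockLaw P c ξ θ (gammaMeasure 1 t) t A =
        ∫⁻ ω, RandomMotion.laplaceMeasure (t ^ 2 / |RandomMotion.position c ξ θ t ω|) A ∂P := by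
  have h : RandomMotion.IsFlight P lam (RandomMotion.angleMeasure ((m : ℕ) : ℝ))
      (RandomMotion.arcExponent m) ξ θ :=
    ⟨hξ_meas, hθ_meas, hξ_law, hθ_law, h_indep, hlam, RandomMotion.mk_integral_cos_pow_pow m⟩
  have hct := mul_pos hc ht
  -- The extended series is measurable and even everywhere, which the Laplace mixture needs; it is
  -- replaced by p^m only almost everywhere.
  set f : ℝ → ℝ≥0∞ := fun x =>
    ∑' n, ENNReal.ofReal (RandomMotion.flightTerm (RandomMotion.arcExponent m) lam c t n x) with hf
  have hfm : Measurable f :=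
    Measurable.tsum fun n => by unfold RandomMotion.flightTerm; fun_prop
  have heven : ∀ x, f (-x) = f x := fun x => by simp [hf, RandomMotion.flightTerm]
  have hfd : f =ᵐ[volume.restrict (Set.Ioo (-(c * t)) (c * t))]
      fun x => ENNReal.ofReal (RandomMotion.density m c lam x t) := by
    filter_upwards [h.ae_tsum_flightTerm hc ht, ae_restrict_mem measurableSet_Ioo] with x h1 h2
    rw [RandomMotion.density_eq_tsum m hc hlam ht h2]
    exact h1
  have hmap := h.map_position_eq_withDensity hc ht
  refine ⟨hmap.trans (withDensity_congr_ae hfd), ?_, fun A hA => ?_⟩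
  · ext A hA
    have h1 := h.clockLaw_apply hc ht hA
    rw [hmap, RandomMotion.lintegral_laplaceMeasure_withDensity hct ht hfm heven hA] at h1
    -- `expMeasure t` unfolds to `gammaMeasure 1 t`, so the two clocks agree by definition.
    refine h1.trans ?_
    congr 2
    ext x
    have hfd' : ∀ᵐ y ∂volume.restrict (Set.Ioo 0 (c * t)),
        f y = ENNReal.ofReal (RandomMotion.density m c lam y t) :=
      ae_restrict_of_ae_restrict_of_subset (Set.Ioo_subset_Ioo_left (neg_nonpos.mpr hct.le)) hfd
    refine lintegral_congr_ae ?_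
    filter_upwards [hfd', ae_restrict_mem measurableSet_Ioo] with y h2 h3
    have hy : 0 < y := h3.1
    rw [h2, ENNReal.ofReal_mul (p := t ^ 2 / (2 * y) * _) (by positivity), ENNReal.ofReal_mul (p := 2) (by norm_num),
      ENNReal.ofReal_ofNat]
  · rw [← lintegral_map' (RandomMotion.measurable_laplaceMeasure_apply ht hA).aemeasurable
      (h.aemeasurable_position c ht)]
    exact h.clockLaw_apply hc ht hA
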